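/- Let $\mathcal L=\mathcal L_0\oplus\mathcal L_1$ be a twisted affine Lie superalgebra over $\mathbb C$ with nonzero odd part, i.e. of one of the types $A(2k,2\ell-1)^{(2)}$ ($k\ge 0,\ \ell\ge1$), $A(2k-1,2\ell-1)^{(2)}$ ($k,\ell\ge 1$, $(k,\ell)\ne(1,1)$), $A(2k,2\ell)^{(4)}$ ($k\ge0,\ \ell\ge1$), $D(k+1,\ell)^{(2)}$ ($k\ge 0,\ \ell\ge1$). Explicitly, $\mathcal L=\bigoplus_{j=0}^{n-1}({}^{[j]}\mathfrak g\otimes t^j\mathbb C[t^{\pm n}])\oplus\mathbb Cc\oplus\mathbb Cd$, where $\mathfrak g$ is the finite-dimensional basic classical simple Lie superalgebra of the given type $A$ or $D$, $n\in\{2,4\}$ is the superscript, $\sigma$ is the standard automorphism of $\mathfrak g$ of order $n$ with ${}^{[0]}\mathfrak g$ of type $\mathfrak{osp}$ (for type $A$, $X\mapsto -Q^{-1}X^{st}Q$, where $st$ is the supertranspose and $Q$ the Gram matrix of a form which is symmetric on the even part, symplectic on the odd part if this has even dimension, and symplectic plus a one-dimensional symmetric form otherwise; for type $D$, conjugation of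 $\mathfrak{osp}(2k+2|2\ell)$ by a reflection of the even part), ${}^{[j]}\mathfrak g$ is its $\zeta^j$-eigenspace for a primitive $n$-th root of unity $\zeta$, $\kappa$ is a nondegenerate even supersymmetric invariant form on $\mathfrak g$ (unique up to a nonzero scalar), and $$[x\otimes t^p+rc+sd,\;y\otimes t^q+r'c+s'd]=[x,y]\otimes t^{p+q}+p\,\kappa(x,y)\delta_{p+q,0}\,c+sq\,y\otimes t^q-s'p\,x\otimes t^p .$$ Let $\mathcal H=(({}^{[0]}\mathfrak g\cap\mathfrak h)\otimes1)\oplus\mathbb Cc\oplus\mathbb Cd$, where $\mathfrak h$ is the standard Cartan subalgebra of $\mathfrak g$; let $(\cdot,\cdot)$ be the form on $\mathcal H^*$ transferred from the nondegenerate restriction to $\mathcal H$ of the invariant form $(x\otimes t^p+rc+sd,\,y\otimes t^q+r'c+s'd)=\kappa(x,y)\delta_{p+q,0}+rs'+sr'$. Let $R\subset\mathcal H^*$ be the root system of $\mathcal L$ and $R_0$ that of $\mathcal L_0$ (both containing $0$), and let $R_{re}^\times=\{\alpha\in R\mid(\alpha,\alpha)\neq0\}$. For an $\mathcal L$-module $M$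 and $\mu\in\mathcal H^*$ put $M^\mu=\{v\in M\mid hv=\mu(h)v\ \ \forall h\in\mathcal H\}$ and $\operatorname{supp}(M)=\{\mu\mid M^\mu\ne0\}$. $M$ is a finite weight module if $M=\bigoplus_\mu M^\mu$ with all $M^\mu$ finite-dimensional. Let $R^{in}$ (resp. $R^{ln}$) be the set of $\alpha\in R_{re}^\times$ such that every $0\ne x\in\mathcal L^\alpha$ acts injectively (resp. locally nilpotently) on $M$. Put $$\mathfrak B_M=\{\alpha\in\operatorname{span}_{\mathbb Z}R\mid \{k\in\mathbb Z^{>0}\mid\lambda+k\alpha\in\operatorname{supp}(M)\}\text{ is finite for all }\lambda\in\operatorname{supp}(M)\},$$ $$\mathfrak C_M=\{\alpha\in\operatorname{span}_{\mathbb Z}R\mid\alpha+\operatorname{supp}(M)\subseteq\operatorname{supp}(M)\}.$$ $M$ has shadow if $R_{re}^\times=R^{in}\cup R^{ln}$, $R^{ln}=\mathfrak B_M\cap R_{re}^\times$ and $R^{in}=\mathfrak C_M\cap R_{re}^\times$. **Theorem.** Let $M$ be a finite weight $\mathcal L$-module having shadow. Suppose $\alpha\in R_0\cap R^{ln}$,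 $-\alpha\in R^{in}$, and $\beta_1,\dots,\beta_t\in R^{in}$ with $(\alpha,\beta_i)=0$, $\alpha+\beta_i\notin R$ and $\alpha-\beta_i\notin R$ for $1\le i\le t$. If there are $\lambda\in\operatorname{supp}(M)$ and positive integers $s_1<s_2<\cdots$ such that $\lambda+s_n\alpha+(s_n+1)(\beta_1+\cdots+\beta_t)\in\operatorname{supp}(M)$ for all $n\ge1$, then the dimensions of the weight spaces of $M$ are not bounded, i.e. there is no $N$ with $\dim M^\mu\le N$ for all $\mu\in\mathcal H^*$. -/

import Mathlib

namespace TwistedAffine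

noncomputable section

set_option linter.unusedSectionVars false

/-! ### Lie superalgebras -/

/-- The sign `(-1) ^ i` for a parity `i`. -/
def eps (i : ZMod 2) : ℂ := if i = 0 then 1 else -1

lemma eps_zero : eps 0 = 1 := by simp [eps]
lemma eps_one : eps 1 = -1 := by simp [eps]
lemma zmod2 (i : ZMod 2) : i = 0 ∨ i = 1 := by revert i; decide
lemma eps_add (i j : ZMod 2) : eps (i + j) = eps i * eps j := by
  rcases zmod2 i with rfl | rfl <;> rcases zmod2 j with rfl | rfl <;>
    simp [eps, show (1 : ZMod 2) + 1 = 0 from rfl]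
lemma eps_mul_self (i : ZMod 2) : eps i * eps i = 1 := by
  rcases zmod2 i with rfl | rfl <;> norm_num [eps]

/-- A complex Lie superalgebra structure on `V`. The `ℤ/2`-grading is recorded by its parity
involution `v ↦ (-1) ^ |v| v`; the homogeneous elements of degree `i` are those with
`parity x = (-1) ^ i x` (see `LieSuperalgebra.part`). -/
structure LieSuperalgebra (V : Type*) [AddCommGroup V] [Module ℂ V] where
  parity : V →ₗ[ℂ] V
  parity_parity : ∀ x, parity (parity x) = x
  br : V →ₗ[ℂ] V →ₗ[ℂ] V
  parity_br : ∀ x y, parity (br x y) = br (parity x) (parity y)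
  skew : ∀ (i j : ZMod 2) (x y : V), parity x = eps i • x → parity y = eps j • y →
    br x y = -(eps (i * j) • br y x)
  jacobi : ∀ (i j : ZMod 2) (x y z : V), parity x = eps i • x → parity y = eps j • y →
    br x (br y z) = br (br x y) z + eps (i * j) • br y (br x z)

namespace LieSuperalgebra

variable {V : Type*} [AddCommGroup V] [Module ℂ V]

/-- The homogeneous component of degree `i`. -/
def part (G : LieSuperalgebra V) (i : ZMod 2) : Submodule ℂ V :=
  LinearMap.eqLocus G.parity (eps i • LinearMap.id)

/-- A graded subspace closed under the bracket is a Lie superalgebra. -/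
def sub (G : LieSuperalgebra V) (S : Submodule ℂ V) (hp : ∀ x ∈ S, G.parity x ∈ S)
    (hb : ∀ x ∈ S, ∀ y ∈ S, G.br x y ∈ S) : LieSuperalgebra S where
  parity := G.parity.restrict hp
  parity_parity x := Subtype.ext (G.parity_parity x)
  br := LinearMap.mk₂ ℂ (fun x y => ⟨G.br x y, hb x x.2 y y.2⟩)
    (fun x y z => Subtype.ext (by simp)) (fun c x y => Subtype.ext (by simp))
    (fun x y z => Subtype.ext (by simp)) (fun c x y => Subtype.ext (by simp))
  parity_br x y := Subtype.ext (G.parity_br x y)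
  skew i j x y hx hy := Subtype.ext
    (G.skew i j x y (congrArg Subtype.val hx) (congrArg Subtype.val hy))
  jacobi i j x y z hx hy := Subtype.ext
    (G.jacobi i j x y z (congrArg Subtype.val hx) (congrArg Subtype.val hy))

lemma exists_hom_rep (G : LieSuperalgebra V) (Z : Submodule ℂ V)
    (hp : Z ≤ Z.comap G.parity) (i : ZMod 2) (x : V ⧸ Z)
    (hx : Z.mapQ Z G.parity hp x = eps i • x) :
    ∃ y : V, Z.mkQ y = x ∧ G.parity y = eps i • y := by
  obtain ⟨v, rfl⟩ := Z.mkQ_surjective x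
  refine ⟨(2⁻¹ : ℂ) • (v + eps i • G.parity v), ?_, ?_⟩
  · have h : Z.mkQ (G.parity v) = eps i • Z.mkQ v := hx
    rw [map_smul, map_add, map_smul, h, smul_smul, eps_mul_self, one_smul, ← two_smul ℂ,
      smul_smul]
    norm_num
  · rw [map_smul, map_add, map_smul, G.parity_parity, smul_comm, smul_add (eps i), smul_smul,
      eps_mul_self, one_smul, add_comm]

/-- The quotient of a Lie superalgebra by a graded ideal. -/
def quot (G : LieSuperalgebra V) (Z : Submodule ℂ V) (hp : Z ≤ Z.comap G.parity)
    (hl : ∀ z ∈ Z, ∀ x, G.br z x ∈ Z) (hr : ∀ z ∈ Z, ∀ x, G.br x z ∈ Z) :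
    LieSuperalgebra (V ⧸ Z) where
  parity := Z.mapQ Z G.parity hp
  parity_parity x := by
    obtain ⟨v, rfl⟩ := Z.mkQ_surjective x
    simp [G.parity_parity]
  br := (G.br.compr₂ Z.mkQ).liftQ₂ Z Z
    (fun z hz => LinearMap.ext fun x => (Submodule.Quotient.mk_eq_zero Z).2 (hl z hz x))
    (fun z hz => LinearMap.ext fun x => (Submodule.Quotient.mk_eq_zero Z).2 (hr z hz x))
  parity_br x y := by
    obtain ⟨v, rfl⟩ := Z.mkQ_surjective x
    obtain ⟨w, rfl⟩ := Z.mkQ_surjective y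
    exact congrArg Z.mkQ (G.parity_br v w)
  skew i j x y hx hy := by
    obtain ⟨v, rfl, hv⟩ := G.exists_hom_rep Z hp i x hx
    obtain ⟨w, rfl, hw⟩ := G.exists_hom_rep Z hp j y hy
    exact congrArg Z.mkQ (G.skew i j v w hv hw)
  jacobi i j x y z hx hy := by
    obtain ⟨v, rfl, hv⟩ := G.exists_hom_rep Z hp i x hx
    obtain ⟨w, rfl, hw⟩ := G.exists_hom_rep Z hp j y hy
    obtain ⟨u, rfl⟩ := Z.mkQ_surjective z
    exact congrArg Z.mkQ (G.jacobi i j v w u hv hw)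

end LieSuperalgebra

/-! ### General linear Lie superalgebras -/

section Matrices

variable {I : Type} [Fintype I] [DecidableEq I] (p : I → ZMod 2)

/-- The parity involution on matrices: the `(a, b)` entry has parity `p a + p b`. -/
def mpar : Matrix I I ℂ →ₗ[ℂ] Matrix I I ℂ where
  toFun X := Matrix.of fun a b => eps (p a + p b) * X a b
  map_add' X Y := by ext a b; simp [mul_add]
  map_smul' c X := by ext a b; simp [mul_left_comm]

lemma mpar_apply (X : Matrix I I ℂ) (a b : I) : mpar p X a b = eps (p a + p b) * X a b := rfl

lemma mpar_mpar (X : Matrix I I ℂ) : mpar p (mpar p X) = X := by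
  ext a b
  rw [mpar_apply, mpar_apply, ← mul_assoc, eps_mul_self, one_mul]

lemma mpar_mul (X Y : Matrix I I ℂ) : mpar p (X * Y) = mpar p X * mpar p Y := by
  ext a b
  simp only [mpar_apply, Matrix.mul_apply, Finset.mul_sum]
  refine Finset.sum_congr rfl fun c _ => ?_
  have h : eps (p a + p b) = eps (p a + p c) * eps (p c + p b) := by
    simp only [eps_add]
    linear_combination (-(eps (p a) * eps (p b))) * eps_mul_self (p c)
  rw [h]; ring

/-- The bilinear map equal to `(-1) ^ (|X| |Y|) Y X` on homogeneous matrices, using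
`(-1) ^ (i j) = (1 + (-1) ^ i + (-1) ^ j - (-1) ^ (i + j)) / 2`. -/
def swapMul : Matrix I I ℂ →ₗ[ℂ] Matrix I I ℂ →ₗ[ℂ] Matrix I I ℂ :=
  LinearMap.mk₂ ℂ (fun X Y => (2⁻¹ : ℂ) • (Y * X + Y * mpar p X + mpar p Y * X
      - mpar p Y * mpar p X))
    (fun X X' Y => by simp only [map_add, mul_add]; module)
    (fun c X Y => by simp only [map_smul, mul_smul_comm]; module)
    (fun X Y Y' => by simp only [map_add, add_mul]; module)
    (fun c X Y => by simp only [map_smul, smul_mul_assoc]; module)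

lemma swapMul_def (X Y : Matrix I I ℂ) : swapMul p X Y = (2⁻¹ : ℂ) •
    (Y * X + Y * mpar p X + mpar p Y * X - mpar p Y * mpar p X) := rfl

lemma swapMul_hom {i j : ZMod 2} {X Y : Matrix I I ℂ} (hX : mpar p X = eps i • X)
    (hY : mpar p Y = eps j • Y) : swapMul p X Y = eps (i * j) • (Y * X) := by
  rw [swapMul_def, hX, hY]
  rcases zmod2 i with rfl | rfl <;> rcases zmod2 j with rfl | rfl <;>
    simp only [eps_zero, eps_one, mul_zero, mul_one, one_smul, mul_smul_comm, smul_mul_assoc] <;>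
    module

lemma swapMul_even {X : Matrix I I ℂ} (hX : mpar p X = X) (Z : Matrix I I ℂ) :
    swapMul p X Z = Z * X := by
  rw [swapMul_def, hX]; module

lemma swapMul_odd {X : Matrix I I ℂ} (hX : mpar p X = -X) (Z : Matrix I I ℂ) :
    swapMul p X Z = mpar p Z * X := by
  rw [swapMul_def, hX, mul_neg, mul_neg]; module

/-- The Lie superalgebra `𝔤𝔩` of matrices, with the supercommutator
`[X, Y] = X Y - (-1) ^ (|X| |Y|) Y X`. -/
def gl : LieSuperalgebra (Matrix I I ℂ) where
  parity := mpar p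
  parity_parity := mpar_mpar p
  br := LinearMap.mul ℂ (Matrix I I ℂ) - swapMul p
  parity_br X Y := by
    simp only [LinearMap.sub_apply, LinearMap.mul_apply', swapMul_def, map_sub, map_smul, map_add,
      mpar_mul, mpar_mpar]
  skew i j X Y hX hY := by
    simp only [LinearMap.sub_apply, LinearMap.mul_apply', swapMul_hom p hX hY,
      swapMul_hom p hY hX, smul_sub, smul_smul, mul_comm j i, eps_mul_self]
    module
  jacobi i j X Y Z hX hY := by
    have hmul : mpar p (X * Y) = eps (i + j) • (X * Y) := by
      rw [mpar_mul, hX, hY, smul_mul_smul_comm, eps_add]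
    have hmul' : mpar p (Y * X) = eps (i + j) • (Y * X) := by
      rw [mpar_mul, hX, hY, smul_mul_smul_comm, eps_add, mul_comm (eps j)]
    have hXY : mpar p (X * Y - swapMul p X Y) = eps (i + j) • (X * Y - swapMul p X Y) := by
      rw [swapMul_hom p hX hY, map_sub, map_smul, hmul, hmul', smul_sub, smul_comm]
    simp only [LinearMap.sub_apply, LinearMap.mul_apply']
    have key : ∀ (k : ZMod 2) (W T : Matrix I I ℂ), mpar p W = eps k • W →
        swapMul p W T = (if k = 0 then T else mpar p T) * W := by
      intro k W T hW
      rcases zmod2 k with rfl | rfl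
      · simpa using swapMul_even p (by simpa [eps_zero] using hW) T
      · simpa using swapMul_odd p (by simpa [eps_one] using hW) T
    rw [key _ _ Z hXY, key i X _ hX, key j Y _ hY, key j Y _ hY, key i X _ hX,
      key i X _ hX]
    rcases zmod2 i with rfl | rfl <;> rcases zmod2 j with rfl | rfl <;>
      simp [eps_zero, eps_one, mpar_mul, mpar_mpar, show (1 : ZMod 2) + 1 = 0 from rfl] at hX hY ⊢ <;>
      (try simp only [hX, hY]) <;> noncomm_ring

lemma gl_br (X Y : Matrix I I ℂ) : (gl p).br X Y = X * Y - swapMul p X Y := rfl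

/-- Entrywise form of the sign rule. -/
lemma swapMul_apply (X Y : Matrix I I ℂ) (a b : I) :
    swapMul p X Y a b = ∑ c, eps ((p a + p c) * (p c + p b)) * (Y a c * X c b) := by
  simp only [swapMul_def, Matrix.smul_apply, Matrix.sub_apply, Matrix.add_apply,
    Matrix.mul_apply, mpar_apply, smul_eq_mul, ← Finset.sum_add_distrib,
    ← Finset.sum_sub_distrib, Finset.mul_sum]
  refine Finset.sum_congr rfl fun c _ => ?_
  rcases zmod2 (p a + p c) with h | h <;> rcases zmod2 (p c + p b) with h' | h' <;>
    simp only [h, h', eps_zero, eps_one, mul_zero, mul_one] <;> ring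

/-- The supertrace. -/
def str : Matrix I I ℂ →ₗ[ℂ] ℂ where
  toFun X := ∑ a, eps (p a) * X a a
  map_add' X Y := by simp [mul_add, Finset.sum_add_distrib]
  map_smul' c X := by simp [Finset.mul_sum, mul_left_comm]

lemma str_apply (X : Matrix I I ℂ) : str p X = ∑ a, eps (p a) * X a a := rfl

lemma add_self_zmod2 (i : ZMod 2) : i + i = 0 := by
  rcases zmod2 i with rfl | rfl <;> rfl

lemma str_mpar (X : Matrix I I ℂ) : str p (mpar p X) = str p X := by
  simp [str_apply, mpar_apply, add_self_zmod2, eps_zero]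

lemma str_mul (X Y : Matrix I I ℂ) : str p (X * Y) = str p (swapMul p X Y) := by
  simp only [str_apply, swapMul_apply, Matrix.mul_apply, Finset.mul_sum]
  rw [Finset.sum_comm]
  refine Finset.sum_congr rfl fun a _ => Finset.sum_congr rfl fun c _ => ?_
  rcases zmod2 (p a) with h | h <;> rcases zmod2 (p c) with h' | h' <;>
    simp [h, h', eps_zero, eps_one, show (1 : ZMod 2) + 1 = 0 from rfl] <;> ring

lemma str_br (X Y : Matrix I I ℂ) : str p ((gl p).br X Y) = 0 := by
  rw [gl_br, map_sub, str_mul, sub_self]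

lemma str_invariant (X Y Z : Matrix I I ℂ) :
    str p ((gl p).br X Y * Z) = str p (X * (gl p).br Y Z) := by
  have h : str p (swapMul p X Y * Z) = str p (X * swapMul p Y Z) := by
    simp only [str_apply, swapMul_apply, Matrix.mul_apply, Finset.mul_sum, Finset.sum_mul]
    calc _ = ∑ a, ∑ c, ∑ b, eps (p a) * (eps ((p a + p c) * (p c + p b)) *
              (Y a c * X c b) * Z b a) :=
          Finset.sum_congr rfl fun a _ => Finset.sum_comm
      _ = ∑ c, ∑ a, ∑ b, eps (p a) * (eps ((p a + p c) * (p c + p b)) *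
              (Y a c * X c b) * Z b a) := Finset.sum_comm
      _ = ∑ c, ∑ b, ∑ a, eps (p a) * (eps ((p a + p c) * (p c + p b)) *
              (Y a c * X c b) * Z b a) :=
          Finset.sum_congr rfl fun a _ => Finset.sum_comm
      _ = _ := by
          refine Finset.sum_congr rfl fun c _ => Finset.sum_congr rfl fun b _ =>
            Finset.sum_congr rfl fun a _ => ?_
          rcases zmod2 (p a) with h | h <;> rcases zmod2 (p b) with h' | h' <;>
            rcases zmod2 (p c) with h'' | h'' <;>
            simp [h, h', h'', eps_zero, eps_one, show (1 : ZMod 2) + 1 = 0 from rfl] <;> ring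
  rw [gl_br, gl_br, sub_mul, mul_sub, map_sub, map_sub, h, mul_assoc]

/-- The supertrace form `(X, Y) ↦ str (X Y)`. -/
def strForm : Matrix I I ℂ →ₗ[ℂ] Matrix I I ℂ →ₗ[ℂ] ℂ :=
  (LinearMap.mul ℂ (Matrix I I ℂ)).compr₂ (str p)

lemma strForm_apply (X Y : Matrix I I ℂ) : strForm p X Y = str p (X * Y) := rfl

/-! The automorphism `X ↦ - Q⁻¹ Xˢᵗ Q`, where `Xˢᵗ` is the supertranspose
`(Xˢᵗ) a b = (-1) ^ (p a (p a + p b)) X b a`, and `Q` is the monomial matrix whose nonzero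
entries are `Q a (ι a) = q a = ± 1` for a parity preserving involution `ι` of the indices. -/

/-- `X ↦ - Q⁻¹ Xˢᵗ Q`. -/
def stAut (ι : I → I) (q : I → ℂ) : Matrix I I ℂ →ₗ[ℂ] Matrix I I ℂ where
  toFun X := Matrix.of fun a b =>
    -(q (ι a) * q (ι b) * eps (p a * (p a + p b)) * X (ι b) (ι a))
  map_add' X Y := by ext a b; simp [mul_add]; ring
  map_smul' c X := by ext a b; simp; ring

variable {ι : I → I} {q : I → ℂ}

lemma stAut_apply (X : Matrix I I ℂ) (a b : I) : stAut p ι q X a b =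
    -(q (ι a) * q (ι b) * eps (p a * (p a + p b)) * X (ι b) (ι a)) := rfl

lemma stAut_mpar (hp : ∀ a, p (ι a) = p a) (X : Matrix I I ℂ) :
    stAut p ι q (mpar p X) = mpar p (stAut p ι q X) := by
  ext a b
  simp only [stAut_apply, mpar_apply, hp, add_comm (p b)]
  ring

lemma stAut_mul (hι : ∀ a, ι (ι a) = a) (hq : ∀ a, q a * q a = 1)
    (X Y : Matrix I I ℂ) :
    stAut p ι q (X * Y) = -swapMul p (stAut p ι q X) (stAut p ι q Y) := by
  ext a b
  simp only [stAut_apply, Matrix.neg_apply, swapMul_apply, Matrix.mul_apply, Finset.mul_sum]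
  congr 1
  refine Fintype.sum_equiv (Equiv.mk ι ι hι hι) _ _ fun c => ?_
  simp only [Equiv.coe_fn_mk, hι]
  have h : eps (p a * (p a + p b)) = eps ((p a + p (ι c)) * (p (ι c) + p b)) *
      (eps (p a * (p a + p (ι c))) * eps (p (ι c) * (p (ι c) + p b))) := by
    rw [← eps_add, ← eps_add]
    congr 1
    generalize p a = i; generalize p b = j; generalize p (ι c) = k
    revert i j k; decide
  rw [h]
  linear_combination (-(q (ι a) * q (ι b) * (eps ((p a + p (ι c)) * (p (ι c) + p b)) *
      (eps (p a * (p a + p (ι c))) * eps (p (ι c) * (p (ι c) + p b)))) *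
      (X (ι b) c * Y c (ι a)))) * hq c

lemma stAut_br (hι : ∀ a, ι (ι a) = a) (hp : ∀ a, p (ι a) = p a) (hq : ∀ a, q a * q a = 1)
    (X Y : Matrix I I ℂ) :
    stAut p ι q ((gl p).br X Y) = (gl p).br (stAut p ι q X) (stAut p ι q Y) := by
  simp only [gl_br, map_sub, stAut_mul p hι hq]
  rw [swapMul_def p X Y]
  simp only [map_smul, map_sub, map_add, stAut_mul p hι hq, stAut_mpar p hp, swapMul_def,
    mpar_mpar]
  module

lemma str_stAut (hι : ∀ a, ι (ι a) = a) (hp : ∀ a, p (ι a) = p a)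
    (hq : ∀ a, q a * q a = 1) (X : Matrix I I ℂ) :
    str p (stAut p ι q X) = -str p X := by
  simp only [str_apply, ← Finset.sum_neg_distrib]
  refine Fintype.sum_equiv (Equiv.mk ι ι hι hι) _ _ fun a => ?_
  simp only [Equiv.coe_fn_mk, stAut_apply, hq, add_self_zmod2, mul_zero, eps_zero, hp]
  ring

lemma stAut_one (hι : ∀ a, ι (ι a) = a) (hq : ∀ a, q a * q a = 1) :
    stAut p ι q (1 : Matrix I I ℂ) = -1 := by
  ext a b
  by_cases h : a = b
  · subst h; simp [stAut_apply, hq, add_self_zmod2, eps_zero]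
  · have h' : ι b ≠ ι a := fun e => h (by rw [← hι a, ← e, hι])
    simp [stAut_apply, h, h']

/-- Diagonal matrices. -/
def diagMat (I : Type) : Submodule ℂ (Matrix I I ℂ) where
  carrier := {X | ∀ a b, a ≠ b → X a b = 0}
  add_mem' := by intro X Y hX hY a b h; simp [hX a b h, hY a b h]
  zero_mem' := by intro a b _; rfl
  smul_mem' := by intro c X hX a b h; simp [hX a b h]

lemma mpar_diag {X : Matrix I I ℂ} (hX : X ∈ diagMat I) : mpar p X = X := by
  ext a b
  by_cases h : a = b
  · subst h; simp [mpar_apply, add_self_zmod2, eps_zero]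
  · simp [mpar_apply, hX a b h]

/-- A diagonal matrix fixed by `stAut` and orthogonal to all such matrices is zero. -/
lemma diag_nondeg (hι : ∀ a, ι (ι a) = a) (hp : ∀ a, p (ι a) = p a)
    (hq : ∀ a, q a * q a = 1) {X : Matrix I I ℂ} (hX : X ∈ diagMat I)
    (hσ : stAut p ι q X = X)
    (h : ∀ Y ∈ diagMat I, stAut p ι q Y = Y → str p (X * Y) = 0) : X = 0 := by
  have hd : ∀ a, X (ι a) (ι a) = -X a a := by
    intro a
    have := congrFun (congrFun hσ a) a
    simp only [stAut_apply, hq, add_self_zmod2, mul_zero, eps_zero] at this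
    linear_combination -this
  have key := h (Matrix.diagonal fun a => eps (p a) * (starRingEnd ℂ) (X a a)) ?_ ?_
  · simp only [str_apply, Matrix.mul_diagonal] at key
    have e : ∑ a, Complex.normSq (X a a) = 0 := by
      have : ((∑ a, Complex.normSq (X a a) : ℝ) : ℂ) = 0 := by
        rw [← key]; push_cast
        refine Finset.sum_congr rfl fun a _ => ?_
        rw [← Complex.mul_conj]
        linear_combination (-(X a a * (starRingEnd ℂ) (X a a))) * eps_mul_self (p a)
      exact_mod_cast this
    ext a b
    by_cases hab : a = b
    · subst hab
      exact Complex.normSq_eq_zero.1 ((Finset.sum_eq_zero_iff_of_nonneg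
        (fun a _ => Complex.normSq_nonneg _)).1 e a (Finset.mem_univ a))
    · exact hX a b hab
  · intro a b hab; exact Matrix.diagonal_apply_ne _ hab
  · ext a b
    by_cases hab : a = b
    · subst hab
      simp only [stAut_apply, hq, add_self_zmod2, mul_zero, eps_zero, Matrix.diagonal_apply_eq,
        hp, hd, map_neg]
      ring
    · have h' : ι b ≠ ι a := fun e => hab (by rw [← hι a, ← e, hι])
      simp [stAut_apply, hab, h']

end Matrices

/-! ### Twisted affinization -/

section Loop

variable {V : Type} [AddCommGroup V] [Module ℂ V] (G : LieSuperalgebra V)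
  (κ : V →ₗ[ℂ] V →ₗ[ℂ] ℂ)

/-! An element `∑ x_p ⊗ t ^ p` of `V ⊗ ℂ[t, t⁻¹]` is the finitely supported function `p ↦ x_p`. -/

/-- The bracket `[x ⊗ t ^ p, y ⊗ t ^ q] = [x, y] ⊗ t ^ (p + q)`. -/
def loopBr : (ℤ →₀ V) →ₗ[ℂ] (ℤ →₀ V) →ₗ[ℂ] (ℤ →₀ V) :=
  Finsupp.lsum ℂ fun p => LinearMap.flip
    (Finsupp.lsum ℂ fun q => (G.br.compr₂ (Finsupp.lsingle (p + q))).flip)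

lemma loopBr_single (p q : ℤ) (x y : V) :
    loopBr G (Finsupp.single p x) (Finsupp.single q y) = Finsupp.single (p + q) (G.br x y) := by
  simp [loopBr]

/-- The derivation `t d/dt`. -/
def loopDeg : (ℤ →₀ V) →ₗ[ℂ] (ℤ →₀ V) :=
  Finsupp.lsum ℂ fun p => (p : ℂ) • Finsupp.lsingle p

lemma loopDeg_single (p : ℤ) (x : V) :
    loopDeg (Finsupp.single p x) = Finsupp.single p ((p : ℂ) • x) := by
  simp [loopDeg]

/-- The form `(x ⊗ t ^ p, y ⊗ t ^ q) ↦ κ (x, y) δ_{p + q, 0}`. -/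
def loopForm : (ℤ →₀ V) →ₗ[ℂ] (ℤ →₀ V) →ₗ[ℂ] ℂ :=
  Finsupp.lsum ℂ fun p => (LinearMap.lcomp ℂ ℂ (Finsupp.lapply (-p))) ∘ₗ κ

lemma loopForm_single (p : ℤ) (x : V) (y : ℤ →₀ V) :
    loopForm κ (Finsupp.single p x) y = κ x (y (-p)) := by
  simp [loopForm]

/-- The parity involution, applied coefficientwise. -/
def loopPar : (ℤ →₀ V) →ₗ[ℂ] (ℤ →₀ V) := Finsupp.mapRange.linearMap G.parity

lemma loopPar_single (p : ℤ) (x : V) :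
    loopPar G (Finsupp.single p x) = Finsupp.single p (G.parity x) := by
  simp [loopPar]

lemma loopPar_loopPar (x : ℤ →₀ V) : loopPar G (loopPar G x) = x := by
  ext p; simp [loopPar, G.parity_parity]

lemma loopPar_br (x y : ℤ →₀ V) :
    loopPar G (loopBr G x y) = loopBr G (loopPar G x) (loopPar G y) := by
  induction x using Finsupp.induction_linear with
  | zero => simp
  | add x x' h h' => simp only [map_add, LinearMap.add_apply, h, h']
  | single p v =>
    induction y using Finsupp.induction_linear with
    | zero => simp
    | add y y' h h' => simp only [map_add, h, h']
    | single r w => simp only [loopBr_single, loopPar_single, G.parity_br]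

lemma loopPar_deg (x : ℤ →₀ V) : loopPar G (loopDeg x) = loopDeg (loopPar G x) := by
  induction x using Finsupp.induction_linear with
  | zero => simp
  | add x x' h h' => simp only [map_add, h, h']
  | single p v => simp only [loopDeg_single, loopPar_single, map_smul]

lemma loop_hom_induction {i : ZMod 2} {P : (ℤ →₀ V) → Prop} (x : ℤ →₀ V)
    (hx : loopPar G x = eps i • x) (h0 : P 0) (hadd : ∀ x y, P x → P y → P (x + y))
    (hs : ∀ p v, G.parity v = eps i • v → P (Finsupp.single p v)) : P x := by
  rw [← Finsupp.sum_single x]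
  refine Finset.sum_induction _ P hadd h0 fun p _ => hs p (x p) ?_
  simpa [loopPar] using congrArg (fun f : ℤ →₀ V => f p) hx

lemma loopBr_skew (i j : ZMod 2) (x y : ℤ →₀ V) (hx : loopPar G x = eps i • x)
    (hy : loopPar G y = eps j • y) : loopBr G x y = -(eps (i * j) • loopBr G y x) := by
  refine loop_hom_induction G (P := fun x => loopBr G x y = -(eps (i * j) • loopBr G y x)) x hx ?_ ?_ ?_
  · simp
  · intro x x' h h'
    simp only [map_add, LinearMap.add_apply, h, h']; module
  · intro p v hv
    refine loop_hom_induction G (P := fun y => loopBr G (Finsupp.single p v) y =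
      -(eps (i * j) • loopBr G y (Finsupp.single p v))) y hy ?_ ?_ ?_
    · simp
    · intro y y' h h'
      simp only [map_add, LinearMap.add_apply, h, h']; module
    · intro r w hw
      simp only [loopBr_single, G.skew i j v w hv hw, Finsupp.single_neg, Finsupp.smul_single,
        add_comm p]

lemma loopBr_jacobi (i j : ZMod 2) (x y z : ℤ →₀ V) (hx : loopPar G x = eps i • x)
    (hy : loopPar G y = eps j • y) : loopBr G x (loopBr G y z) =
      loopBr G (loopBr G x y) z + eps (i * j) • loopBr G y (loopBr G x z) := by
  refine loop_hom_induction G (P := fun x => loopBr G x (loopBr G y z) =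
      loopBr G (loopBr G x y) z + eps (i * j) • loopBr G y (loopBr G x z)) x hx ?_ ?_ ?_
  · simp
  · intro x x' h h'
    simp only [map_add, LinearMap.add_apply, h, h']; module
  · intro p v hv
    refine loop_hom_induction G (P := fun y => loopBr G (Finsupp.single p v) (loopBr G y z) =
      loopBr G (loopBr G (Finsupp.single p v) y) z +
        eps (i * j) • loopBr G y (loopBr G (Finsupp.single p v) z)) y hy ?_ ?_ ?_
    · simp
    · intro y y' h h'
      simp only [map_add, LinearMap.add_apply, h, h']; module
    · intro r w hw
      induction z using Finsupp.induction_linear with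
      | zero => simp
      | add z z' h h' => simp only [map_add, h, h']; module
      | single m u =>
        simp only [loopBr_single, G.jacobi i j v w u hv hw, Finsupp.single_add,
          Finsupp.smul_single, add_assoc, add_left_comm r p]

lemma loopDeg_br (x y : ℤ →₀ V) :
    loopDeg (loopBr G x y) = loopBr G (loopDeg x) y + loopBr G x (loopDeg y) := by
  induction x using Finsupp.induction_linear with
  | zero => simp
  | add x x' h h' => simp only [map_add, LinearMap.add_apply, h, h']; module
  | single p v =>
    induction y using Finsupp.induction_linear with
    | zero => simp
    | add y y' h h' => simp only [map_add, h, h']; module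
    | single r w =>
      simp only [loopBr_single, loopDeg_single, map_smul, LinearMap.smul_apply,
        ← Finsupp.single_add, ← add_smul, Int.cast_add]

lemma loopForm_deg (x y : ℤ →₀ V) :
    loopForm κ (loopDeg x) y = -loopForm κ x (loopDeg y) := by
  induction x using Finsupp.induction_linear with
  | zero => simp
  | add x x' h h' => simp only [map_add, LinearMap.add_apply, h, h']; ring
  | single p v =>
    induction y using Finsupp.induction_linear with
    | zero => simp
    | add y y' h h' => simp only [map_add, h, h']; ring
    | single r w =>
      simp only [loopForm_single, loopDeg_single, Finsupp.single_apply]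
      split_ifs with h
      · subst h; simp
      · simp

variable {κ}

lemma loopForm_symm (hs : ∀ (i j : ZMod 2) (x y : V), G.parity x = eps i • x →
      G.parity y = eps j • y → κ x y = eps (i * j) * κ y x)
    (i j : ZMod 2) (x y : ℤ →₀ V) (hx : loopPar G x = eps i • x)
    (hy : loopPar G y = eps j • y) : loopForm κ x y = eps (i * j) * loopForm κ y x := by
  refine loop_hom_induction G (P := fun x => loopForm κ x y = eps (i * j) * loopForm κ y x) x hx ?_ ?_ ?_
  · simp
  · intro x x' h h'
    simp only [map_add, LinearMap.add_apply, h, h']; ring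
  · intro p v hv
    refine loop_hom_induction G (P := fun y => loopForm κ (Finsupp.single p v) y =
      eps (i * j) * loopForm κ y (Finsupp.single p v)) y hy ?_ ?_ ?_
    · simp
    · intro y y' h h'
      simp only [map_add, LinearMap.add_apply, h, h']; ring
    · intro r w hw
      simp only [loopForm_single, Finsupp.single_apply]
      by_cases h : r = -p
      · subst h; simp [hs i j v w hv hw]
      · rw [if_neg h, if_neg (fun e => h (by omega))]; simp

lemma loopForm_inv (hinv : ∀ x y z, κ (G.br x y) z = κ x (G.br y z)) (x y z : ℤ →₀ V) :
    loopForm κ (loopBr G x y) z = loopForm κ x (loopBr G y z) := by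
  induction x using Finsupp.induction_linear with
  | zero => simp
  | add x x' h h' => simp only [map_add, LinearMap.add_apply, h, h']
  | single p v =>
    induction y using Finsupp.induction_linear with
    | zero => simp
    | add y y' h h' => simp only [map_add, LinearMap.add_apply, h, h']
    | single r w =>
      induction z using Finsupp.induction_linear with
      | zero => simp
      | add z z' h h' => simp only [map_add, h, h']
      | single m u =>
        simp only [loopBr_single, loopForm_single, Finsupp.single_apply]
        by_cases h : m = -(p + r)
        · rw [if_pos h, if_pos (by omega), hinv]
        · rw [if_neg h, if_neg (by omega)]; simp

/-- The bracket of the affinization, see `affineBr_apply`. -/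
def affineBr (κ : V →ₗ[ℂ] V →ₗ[ℂ] ℂ) :
    ((ℤ →₀ V) × ℂ × ℂ) →ₗ[ℂ] ((ℤ →₀ V) × ℂ × ℂ) →ₗ[ℂ] ((ℤ →₀ V) × ℂ × ℂ) :=
  let x : ((ℤ →₀ V) × ℂ × ℂ) →ₗ[ℂ] (ℤ →₀ V) := LinearMap.fst ℂ _ _
  let s : ((ℤ →₀ V) × ℂ × ℂ) →ₗ[ℂ] ℂ := LinearMap.snd ℂ ℂ ℂ ∘ₗ LinearMap.snd ℂ _ _
  let D := (LinearMap.lsmul ℂ (ℤ →₀ V)).compl₁₂ s (loopDeg ∘ₗ x)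
  ((loopBr G).compl₁₂ x x + D - D.flip).compr₂ (LinearMap.inl ℂ _ _) +
    ((loopForm κ).compl₁₂ (loopDeg ∘ₗ x) x).compr₂ (LinearMap.inr ℂ _ _ ∘ₗ LinearMap.inl ℂ _ _)

lemma affineBr_apply (κ : V →ₗ[ℂ] V →ₗ[ℂ] ℂ) (x y : ℤ →₀ V) (r s r' s' : ℂ) :
    affineBr G κ (x, r, s) (y, r', s') =
      (loopBr G x y + s • loopDeg y - s' • loopDeg x, loopForm κ (loopDeg x) y, 0) := by
  simp [affineBr]

/-- The affinization `(V ⊗ ℂ[t, t⁻¹]) ⊕ ℂ c ⊕ ℂ d`: the triple `(x, r, s)` is `x + r c + s d`,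
and `[x ⊗ t ^ p + r c + s d, y ⊗ t ^ q + r' c + s' d]` is
`[x, y] ⊗ t ^ (p + q) + p κ (x, y) δ_{p + q, 0} c + s q y ⊗ t ^ q - s' p x ⊗ t ^ p`.
The elements `c` and `d` are even. -/
def affine (κ : V →ₗ[ℂ] V →ₗ[ℂ] ℂ)
    (hs : ∀ (i j : ZMod 2) (x y : V), G.parity x = eps i • x →
      G.parity y = eps j • y → κ x y = eps (i * j) * κ y x)
    (he : ∀ x y, κ (G.parity x) (G.parity y) = κ x y)
    (hinv : ∀ x y z, κ (G.br x y) z = κ x (G.br y z)) :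
    LieSuperalgebra ((ℤ →₀ V) × ℂ × ℂ) where
  parity := LinearMap.prodMap (loopPar G) LinearMap.id
  parity_parity x := by simp [loopPar_loopPar]
  br := affineBr G κ
  parity_br x y := by
    obtain ⟨x, r, s⟩ := x
    obtain ⟨y, r', s'⟩ := y
    simp only [LinearMap.prodMap_apply, affineBr_apply, LinearMap.id_apply]
    refine Prod.ext ?_ (Prod.ext ?_ rfl)
    · simp [loopPar_br, loopPar_deg]
    · have h : ∀ a b, loopForm κ (loopPar G a) (loopPar G b) = loopForm κ a b := by
        intro a b
        induction a using Finsupp.induction_linear with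
        | zero => simp
        | add x x' h h' => simp only [map_add, LinearMap.add_apply, h, h']
        | single p v => simp [loopForm_single, loopPar, he]
      simp [← loopPar_deg, h]
  skew i j x y hx hy := by
    obtain ⟨x, r, s⟩ := x
    obtain ⟨y, r', s'⟩ := y
    simp only [LinearMap.prodMap_apply, Prod.smul_mk, Prod.mk.injEq, LinearMap.id_apply] at hx hy
    obtain ⟨hx, -, hsx⟩ := hx
    obtain ⟨hy, -, hsy⟩ := hy
    have hDx : loopPar G (loopDeg x) = eps i • loopDeg x := by rw [loopPar_deg, hx, map_smul]
    have h2 := loopForm_symm G hs i j _ y hDx hy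
    have h3 := loopForm_deg κ y x
    simp only [affineBr_apply]
    refine Prod.ext ?_ (Prod.ext ?_ ?_)
    · simp only [Prod.fst_neg, Prod.smul_fst, loopBr_skew G i j x y hx hy]
      rcases zmod2 i with rfl | rfl <;> rcases zmod2 j with rfl | rfl <;>
        simp [eps_zero, eps_one, self_eq_neg] at hsx hsy ⊢ <;> (try simp [hsx, hsy]) <;> abel
    · simp only [Prod.snd_neg, Prod.smul_snd, Prod.fst_neg, Prod.smul_fst,
        h2, h3, smul_eq_mul]
      ring
    · simp
  jacobi i j x y z hx hy := by
    obtain ⟨x, r, s⟩ := x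
    obtain ⟨y, r', s'⟩ := y
    obtain ⟨z, r'', s''⟩ := z
    simp only [LinearMap.prodMap_apply, Prod.smul_mk, Prod.mk.injEq, LinearMap.id_apply] at hx hy
    obtain ⟨hx, -, hsx⟩ := hx
    obtain ⟨hy, -, hsy⟩ := hy
    have hDx : loopPar G (loopDeg x) = eps i • loopDeg x := by rw [loopPar_deg, hx, map_smul]
    have hDy : loopPar G (loopDeg y) = eps j • loopDeg y := by rw [loopPar_deg, hy, map_smul]
    have h1 := loopBr_jacobi G i j x y z hx hy
    have h2 := loopBr_skew G i j _ y hDx hy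
    have h3 := loopForm_symm G hs i j _ _ hDx hDy
    have h4 := loopBr_skew G i j x _ hx hDy
    have h5 := loopForm_deg κ (loopDeg y) z
    have h6 := loopForm_deg κ (loopDeg x) z
    have hsx' : eps (i * j) * s = s := by
      rcases zmod2 i with rfl | rfl
      · simp [eps_zero]
      · have : s = 0 := by simpa [eps_one, self_eq_neg] using hsx
        simp [this]
    have hsy' : eps (i * j) * s' = s' := by
      rcases zmod2 j with rfl | rfl
      · simp [eps_zero]
      · have : s' = 0 := by simpa [eps_one, self_eq_neg] using hsy
        simp [this]
    simp only [affineBr_apply]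
    refine Prod.ext ?_ (Prod.ext ?_ ?_)
    · simp only [Prod.fst_add, Prod.smul_fst, map_add, map_sub, map_smul,
        LinearMap.add_apply, LinearMap.sub_apply, LinearMap.smul_apply, h1, h2, loopDeg_br,
        smul_add, smul_sub, smul_smul, smul_neg, zero_smul]
      have e1 : eps (i * j) * s * s' = s * s' := by rw [hsx']
      simp only [← mul_assoc, hsx', hsy']
      module
    · simp only [Prod.snd_add, Prod.smul_snd, Prod.fst_add, Prod.smul_fst,
        map_add, map_sub, map_smul, LinearMap.add_apply, LinearMap.sub_apply,
        LinearMap.smul_apply, loopDeg_br, loopForm_inv G hinv, smul_eq_mul, h3, h5, h6]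
      have h7 : loopForm κ x (loopBr G (loopDeg y) z) =
          -(eps (i * j) * loopForm κ (loopDeg y) (loopBr G x z)) := by
        rw [← loopForm_inv G hinv, h4, map_neg, map_smul, LinearMap.neg_apply,
          LinearMap.smul_apply, loopForm_inv G hinv, smul_eq_mul]
      rw [h7]
      linear_combination (-loopForm κ (loopDeg y) (loopDeg z)) * hsx'
    · simp

end Loop

/-- Data for a twisted affinization: a finite-dimensional Lie superalgebra `G` with an even
supersymmetric invariant bilinear form `κ`, a subalgebra `h`, an automorphism `σ`, and a scalar
`ζ` (a root of unity of the order of `σ`). -/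
structure TwistData where
  V : Type
  [acg : AddCommGroup V]
  [mod : Module ℂ V]
  [fd : FiniteDimensional ℂ V]
  G : LieSuperalgebra V
  κ : V →ₗ[ℂ] V →ₗ[ℂ] ℂ
  κ_symm : ∀ (i j : ZMod 2) (x y : V), G.parity x = eps i • x → G.parity y = eps j • y →
    κ x y = eps (i * j) * κ y x
  κ_even : ∀ x y, κ (G.parity x) (G.parity y) = κ x y
  κ_inv : ∀ x y z, κ (G.br x y) z = κ x (G.br y z)
  σ : V →ₗ[ℂ] V
  σ_br : ∀ x y, σ (G.br x y) = G.br (σ x) (σ y)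
  σ_parity : ∀ x, σ (G.parity x) = G.parity (σ x)
  ζ : ℂ
  ζ_ne : ζ ≠ 0
  h : Submodule ℂ V
  h_even : ∀ x ∈ h, G.parity x = x
  h_nondeg : ∀ x ∈ h, σ x = x → (∀ y ∈ h, σ y = y → κ x y = 0) → x = 0

attribute [instance] TwistData.acg TwistData.mod TwistData.fd

namespace TwistData

variable (D : TwistData)

/-- The elements `∑ x_p ⊗ t ^ p` with `σ x_p = ζ ^ p x_p` for all `p`. -/
def loop : Submodule ℂ (ℤ →₀ D.V) where
  carrier := {x | ∀ p, D.σ (x p) = D.ζ ^ p • x p}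
  add_mem' := by intro x y hx hy p; simp [hx p, hy p]
  zero_mem' := by intro p; simp
  smul_mem' := by intro c x hx p; simp [hx p, smul_comm c]

lemma single_mem_loop {p : ℤ} {v : D.V} (h : D.σ v = D.ζ ^ p • v) :
    Finsupp.single p v ∈ D.loop := by
  intro q
  by_cases e : q = p
  · subst e; simp [h]
  · simp [e]

lemma loop_par {x : ℤ →₀ D.V} (hx : x ∈ D.loop) : loopPar D.G x ∈ D.loop := by
  intro p
  simp [loopPar, D.σ_parity, hx p]

lemma loop_deg {x : ℤ →₀ D.V} (hx : x ∈ D.loop) : loopDeg x ∈ D.loop := by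
  rw [← Finsupp.sum_single x, Finsupp.sum, map_sum]
  refine Submodule.sum_mem _ fun p _ => ?_
  rw [loopDeg_single]
  exact D.single_mem_loop (by rw [map_smul, hx p, smul_comm])

lemma loop_br {x y : ℤ →₀ D.V} (hx : x ∈ D.loop) (hy : y ∈ D.loop) :
    loopBr D.G x y ∈ D.loop := by
  rw [← Finsupp.sum_single x, ← Finsupp.sum_single y, Finsupp.sum, Finsupp.sum, map_sum]
  simp only [LinearMap.sum_apply, map_sum]
  refine Submodule.sum_mem _ fun q _ => ?_
  refine Submodule.sum_mem _ fun p _ => ?_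
  rw [loopBr_single]
  refine D.single_mem_loop ?_
  rw [D.σ_br, hx p, hy q, zpow_add₀ D.ζ_ne]
  simp [smul_smul, mul_comm]

/-- The twisted affinization `𝓛 = ⨁ ([j]𝔤 ⊗ t ^ j ℂ[t ^ n, t ^ (-n)]) ⊕ ℂ c ⊕ ℂ d`, as a
subspace of the affinization. -/
def L : Submodule ℂ ((ℤ →₀ D.V) × ℂ × ℂ) := D.loop.comap (LinearMap.fst ℂ _ _)

/-- The Lie superalgebra structure of the twisted affinization. -/
def lie : LieSuperalgebra D.L :=
  (affine D.G D.κ D.κ_symm D.κ_even D.κ_inv).sub D.L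
    (fun _ hx => D.loop_par hx)
    (fun x hx y hy => by
      obtain ⟨x, r, s⟩ := x
      obtain ⟨y, r', s'⟩ := y
      change affineBr D.G D.κ _ _ ∈ _
      rw [affineBr_apply]
      exact D.loop.sub_mem (D.loop.add_mem (D.loop_br hx hy)
        (D.loop.smul_mem _ (D.loop_deg hy))) (D.loop.smul_mem _ (D.loop_deg hx)))

/-- The invariant form
`(x ⊗ t ^ p + r c + s d, y ⊗ t ^ q + r' c + s' d) = κ (x, y) δ_{p + q, 0} + r s' + s r'`. -/
def form : LinearMap.BilinForm ℂ D.L :=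
  LinearMap.mk₂ ℂ (fun x y => loopForm D.κ x.1.1 y.1.1 + x.1.2.1 * y.1.2.2 + x.1.2.2 * y.1.2.1)
    (fun x y z => by simp; ring) (fun c x y => by simp; ring)
    (fun x y z => by simp; ring) (fun c x y => by simp; ring)

/-- The Cartan subalgebra `(([0]𝔤 ∩ h) ⊗ 1) ⊕ ℂ c ⊕ ℂ d` of `𝓛`. -/
def hh : Submodule ℂ D.L where
  carrier := {x | (∀ p ≠ 0, x.1.1 p = 0) ∧ x.1.1 0 ∈ D.h}
  add_mem' := by
    rintro x y ⟨hx, hx'⟩ ⟨hy, hy'⟩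
    exact ⟨fun p hp => by simp [hx p hp, hy p hp], by simpa using D.h.add_mem hx' hy'⟩
  zero_mem' := ⟨fun p _ => by simp, by simp⟩
  smul_mem' := by
    rintro c x ⟨hx, hx'⟩
    exact ⟨fun p hp => by simp [hx p hp], by simpa using D.h.smul_mem c hx'⟩

/-- The dual space of the Cartan subalgebra. -/
abbrev HDual : Type := Module.Dual ℂ D.hh

lemma hh_eq_single (x : D.hh) : x.1.1.1 = Finsupp.single 0 (x.1.1.1 0) := by
  ext p
  by_cases h : p = 0
  · subst h; simp
  · rw [x.2.1 p h, Finsupp.single_eq_of_ne h]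

instance : FiniteDimensional ℂ D.hh := by
  let f : D.hh →ₗ[ℂ] D.V × ℂ × ℂ :=
    { toFun := fun x => (x.1.1.1 0, x.1.1.2)
      map_add' := fun _ _ => rfl
      map_smul' := fun _ _ => rfl }
  refine FiniteDimensional.of_injective f fun x y h => ?_
  obtain ⟨h1, h2⟩ := Prod.mk.inj (show (x.1.1.1 0, x.1.1.2) = (y.1.1.1 0, y.1.1.2) from h)
  refine Subtype.ext (Subtype.ext (Prod.ext ?_ h2))
  rw [hh_eq_single, h1, ← hh_eq_single]

/-- The restriction of the invariant form to the Cartan subalgebra. -/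
def hForm : LinearMap.BilinForm ℂ D.hh := D.form.domRestrict₁₂ D.hh D.hh

lemma hForm_apply (x y : D.hh) : D.hForm x y =
    D.κ (x.1.1.1 0) (y.1.1.1 0) + x.1.1.2.1 * y.1.1.2.2 + x.1.1.2.2 * y.1.1.2.1 := by
  change loopForm D.κ x.1.1.1 y.1.1.1 + _ + _ = _
  rw [hh_eq_single, loopForm_single]
  simp

lemma hForm_symm (x y : D.hh) : D.hForm x y = D.hForm y x := by
  rw [hForm_apply, hForm_apply, D.κ_symm 0 0 _ _ (by simp [eps_zero, D.h_even _ x.2.2])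
    (by simp [eps_zero, D.h_even _ y.2.2])]
  simp only [mul_zero, eps_zero]
  ring

lemma hForm_nondegenerate : D.hForm.Nondegenerate := by
  have key : ∀ x : D.hh, (∀ y, D.hForm x y = 0) → x = 0 := by
    intro x hx
    have mem : ∀ v ∈ D.h, D.σ v = v → ∀ r s : ℂ,
        ∃ y : D.hh, y.1.1.1 0 = v ∧ y.1.1.2 = (r, s) := by
      intro v hv hσ r s
      refine ⟨⟨⟨(Finsupp.single 0 v, r, s), D.single_mem_loop (by simp [hσ])⟩, ?_, ?_⟩, ?_, rfl⟩
      · intro p hp; simp [hp]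
      · simpa using hv
      · simp
    have hr : x.1.1.2.1 = 0 := by
      obtain ⟨y, h1, h2⟩ := mem 0 D.h.zero_mem (map_zero _) 0 1
      simpa [hForm_apply, h1, h2] using hx y
    have hs : x.1.1.2.2 = 0 := by
      obtain ⟨y, h1, h2⟩ := mem 0 D.h.zero_mem (map_zero _) 1 0
      simpa [hForm_apply, h1, h2] using hx y
    have hv : x.1.1.1 0 = 0 := by
      refine D.h_nondeg _ x.2.2 (by simpa using x.1.2 0) fun v hv hσ => ?_
      obtain ⟨y, h1, h2⟩ := mem v hv hσ 0 0
      simpa [hForm_apply, h1, h2] using hx y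
    refine Subtype.ext (Subtype.ext (Prod.ext ?_ (Prod.ext hr hs)))
    rw [hh_eq_single, hv]; simp
  exact ⟨key, fun y hy => key y fun x => by rw [hForm_symm]; exact hy x⟩

/-- The form transferred to the dual of the Cartan subalgebra: `(α, β) = (t_α, t_β)`, where
`t_α` is the element of the Cartan subalgebra with `(t_α, ·) = α`. -/
def dualForm (α β : D.HDual) : ℂ :=
  D.hForm ((D.hForm.toDual D.hForm_nondegenerate).symm α)
    ((D.hForm.toDual D.hForm_nondegenerate).symm β)

/-- The root space `𝓛 ^ α`. -/
def rootSpace (α : D.HDual) : Submodule ℂ D.L where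
  carrier := {x | ∀ h : D.hh, D.lie.br h x = α h • x}
  add_mem' := by intro x y hx hy h; rw [map_add, hx h, hy h, smul_add]
  zero_mem' := by intro h; simp
  smul_mem' := by intro c x hx h; rw [map_smul, hx h, smul_comm]

/-- The root system `R` of `𝓛` (it contains `0`). -/
def R : Set D.HDual := {α | D.rootSpace α ≠ ⊥}

/-- The root system `R₀` of the even part `𝓛₀`. -/
def R₀ : Set D.HDual := {α | D.rootSpace α ⊓ D.lie.part 0 ≠ ⊥}

/-- The nonzero real roots. -/
def reRoots : Set D.HDual := {α | α ∈ D.R ∧ D.dualForm α α ≠ 0}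

end TwistData

/-! ### Modules -/

/-- A module over a Lie superalgebra. (A `ℤ/2`-grading of the module plays no role here, so it is
not part of the structure; every `ℤ/2`-graded module gives one by forgetting its grading.) -/
structure SuperModule {V : Type*} [AddCommGroup V] [Module ℂ V] (G : LieSuperalgebra V)
    (M : Type*) [AddCommGroup M] [Module ℂ M] where
  act : V →ₗ[ℂ] M →ₗ[ℂ] M
  act_br : ∀ (i j : ZMod 2), ∀ x ∈ G.part i, ∀ y ∈ G.part j, ∀ m : M,
    act (G.br x y) m = act x (act y m) - eps (i * j) • act y (act x m)

namespace SuperModule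

variable {D : TwistData} {M : Type*} [AddCommGroup M] [Module ℂ M] (ρ : SuperModule D.lie M)

/-- The weight space `M ^ μ`. -/
def weightSpace (μ : D.HDual) : Submodule ℂ M where
  carrier := {v | ∀ h : D.hh, ρ.act h v = μ h • v}
  add_mem' := by intro x y hx hy h; rw [map_add, hx h, hy h, smul_add]
  zero_mem' := by intro h; simp
  smul_mem' := by intro c x hx h; rw [map_smul, hx h, smul_comm]

/-- The support, that is, the set of weights. -/
def supp : Set D.HDual := {μ | ρ.weightSpace μ ≠ ⊥}

open scoped Classical in
/-- `M` is the direct sum of its weight spaces. -/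
def IsWeight : Prop := DirectSum.IsInternal ρ.weightSpace

/-- A weight module all of whose weight spaces are finite-dimensional. -/
def IsFiniteWeight : Prop := ρ.IsWeight ∧ ∀ μ, FiniteDimensional ℂ (ρ.weightSpace μ)

/-- Nonzero real roots whose nonzero root vectors act injectively. -/
def Rin : Set D.HDual :=
  {α | α ∈ D.reRoots ∧ ∀ x ∈ D.rootSpace α, x ≠ 0 → Function.Injective (ρ.act x)}

/-- Nonzero real roots whose nonzero root vectors act locally nilpotently. -/
def Rln : Set D.HDual :=
  {α | α ∈ D.reRoots ∧ ∀ x ∈ D.rootSpace α, x ≠ 0 → ∀ v : M, ∃ n : ℕ, (ρ.act x ^ n) v = 0}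

/-- The set `𝔅_M`. -/
def B : Set D.HDual :=
  {α | α ∈ Submodule.span ℤ D.R ∧ ∀ μ ∈ ρ.supp, {k : ℕ | 0 < k ∧ μ + k • α ∈ ρ.supp}.Finite}

/-- The set `ℭ_M`. -/
def C : Set D.HDual :=
  {α | α ∈ Submodule.span ℤ D.R ∧ ∀ μ ∈ ρ.supp, α + μ ∈ ρ.supp}

/-- `M` has shadow. -/
def HasShadow : Prop :=
  D.reRoots = ρ.Rin ∪ ρ.Rln ∧ ρ.Rln = ρ.B ∩ D.reRoots ∧ ρ.Rin = ρ.C ∩ D.reRoots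

end SuperModule

/-! ### The twisted affine Lie superalgebras -/

/-- Indices of the standard basis: `k` pairs of opposite even vectors (weights `± ε_i`), `s` even
vectors of weight `0`, `l` pairs of opposite odd vectors (weights `± δ_j`), `t` odd vectors of
weight `0`. -/
abbrev Idx (k l s t : ℕ) : Type := (Fin k ⊕ Fin k ⊕ Fin s) ⊕ (Fin l ⊕ Fin l ⊕ Fin t)

section Types

variable {k l s t : ℕ}

/-- Parity of a basis vector. -/
def ipar : Idx k l s t → ZMod 2 := Sum.elim (fun _ => 0) (fun _ => 1)

/-- The involution exchanging opposite basis vectors. -/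
def opp : Idx k l s t → Idx k l s t
  | .inl (.inl i) => .inl (.inr (.inl i))
  | .inl (.inr (.inl i)) => .inl (.inl i)
  | .inr (.inl j) => .inr (.inr (.inl j))
  | .inr (.inr (.inl j)) => .inr (.inl j)
  | a => a

/-- The signs defining the (symplectic) form on the odd vectors. -/
def qsgn : Idx k l s t → ℂ
  | .inr (.inr (.inl _)) => -1
  | _ => 1

lemma opp_opp (a : Idx k l s t) : opp (opp a) = a := by
  rcases a with (_ | _ | _) | (_ | _ | _) <;> rfl
lemma ipar_opp (a : Idx k l s t) : ipar (opp a) = ipar a := by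
  rcases a with (_ | _ | _) | (_ | _ | _) <;> rfl
lemma qsgn_mul (a : Idx k l s t) : qsgn a * qsgn a = 1 := by
  rcases a with (_ | _ | _) | (_ | _ | _) <;> simp [qsgn]

variable (k l s t)

/-- The special linear matrices: those of supertrace zero. -/
def sl : Submodule ℂ (Matrix (Idx k l s t) (Idx k l s t) ℂ) := LinearMap.ker (str ipar)

/-- `𝔰𝔩(2k + s | 2l + t)`. -/
def slAlg : LieSuperalgebra (sl k l s t) :=
  (gl ipar).sub (sl k l s t) (fun X hX => (str_mpar ipar X).trans hX)
    (fun X _ Y _ => str_br ipar X Y)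

/-- The scalar matrices in `𝔰𝔩`; this is `0` unless `2k + s = 2l + t`. -/
def scalars : Submodule ℂ (sl k l s t) := (Submodule.span ℂ {1}).comap (sl k l s t).subtype

variable {k l s t}

lemma mem_scalars {X : sl k l s t} (hX : X ∈ scalars k l s t) :
    ∃ c : ℂ, X.1 = c • (1 : Matrix (Idx k l s t) (Idx k l s t) ℂ) := by
  obtain ⟨c, hc⟩ := Submodule.mem_span_singleton.1 hX
  exact ⟨c, hc.symm⟩

lemma mpar_one {I : Type} [Fintype I] [DecidableEq I] (p : I → ZMod 2) :
    mpar p (1 : Matrix I I ℂ) = 1 :=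
  mpar_diag p fun a b h => Matrix.one_apply_ne h

lemma gl_br_one {I : Type} [Fintype I] [DecidableEq I] (p : I → ZMod 2) (X : Matrix I I ℂ) :
    (gl p).br 1 X = 0 ∧ (gl p).br X 1 = 0 := by
  constructor
  · rw [gl_br, swapMul_even p (mpar_one p)]; simp
  · rw [gl_br, swapMul_def, mpar_one, one_mul, one_mul, mul_one]; module

variable (k l s t)

/-- The underlying space of the basic classical simple Lie superalgebra
`A(2k + s - 1, 2l + t - 1)`. -/
abbrev AType : Type := sl k l s t ⧸ scalars k l s t

lemma scalars_parity :
    scalars k l s t ≤ (scalars k l s t).comap (slAlg k l s t).parity := fun X hX => by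
  obtain ⟨c, hc⟩ := mem_scalars hX
  refine Submodule.mem_span_singleton.2 ⟨c, ?_⟩
  change _ = mpar ipar X.1
  rw [hc, map_smul, mpar_one]

/-- `A(2k + s - 1, 2l + t - 1)`: the quotient of `𝔰𝔩(2k + s | 2l + t)` by its scalar matrices. -/
def aAlg : LieSuperalgebra (AType k l s t) :=
  (slAlg k l s t).quot (scalars k l s t) (scalars_parity k l s t)
    (fun X hX Y => by
      obtain ⟨c, hc⟩ := mem_scalars hX
      have : (slAlg k l s t).br X Y = 0 := Subtype.ext (by
        change (gl ipar).br X.1 Y.1 = 0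
        rw [hc, map_smul, LinearMap.smul_apply, (gl_br_one _ _).1, smul_zero])
      rw [this]; exact Submodule.zero_mem _)
    (fun X hX Y => by
      obtain ⟨c, hc⟩ := mem_scalars hX
      have : (slAlg k l s t).br Y X = 0 := Subtype.ext (by
        change (gl ipar).br Y.1 X.1 = 0
        rw [hc, map_smul, (gl_br_one _ _).2, smul_zero])
      rw [this]; exact Submodule.zero_mem _)

/-- The form on `A(2k + s - 1, 2l + t - 1)` induced by `a • str (X Y)`. -/
def aForm (a : ℂ) : AType k l s t →ₗ[ℂ] AType k l s t →ₗ[ℂ] ℂ :=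
  ((a • strForm ipar).domRestrict₁₂ (sl k l s t) (sl k l s t)).liftQ₂
    (scalars k l s t) (scalars k l s t)
    (fun X hX => LinearMap.ext fun Y => by
      obtain ⟨c, hc⟩ := mem_scalars hX
      have h : str ipar Y.1 = 0 := Y.2
      change a * str ipar (X.1 * Y.1) = 0
      rw [hc, smul_mul_assoc, one_mul, map_smul, h, smul_zero, mul_zero])
    (fun X hX => LinearMap.ext fun Y => by
      obtain ⟨c, hc⟩ := mem_scalars hX
      have h : str ipar Y.1 = 0 := Y.2
      change a * str ipar (Y.1 * X.1) = 0
      rw [hc, mul_smul_comm, mul_one, map_smul, h, smul_zero, mul_zero])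

/-- `X ↦ - Q⁻¹ Xˢᵗ Q` on `𝔰𝔩`. -/
def slAut : sl k l s t →ₗ[ℂ] sl k l s t :=
  (stAut ipar opp qsgn).restrict (p := sl k l s t) (q := sl k l s t) fun X hX => by
    have h : str ipar X = 0 := hX
    change str ipar _ = 0
    rw [str_stAut ipar opp_opp ipar_opp qsgn_mul, h, neg_zero]

/-- The automorphism of `A(2k + s - 1, 2l + t - 1)` induced by `X ↦ - Q⁻¹ Xˢᵗ Q`. It has order `2`
if `t = 0`, and order `4` if `t = 1`. -/
def aAut : AType k l s t →ₗ[ℂ] AType k l s t :=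
  (scalars k l s t).mapQ (scalars k l s t) (slAut k l s t) fun X hX => by
    obtain ⟨c, hc⟩ := mem_scalars hX
    refine Submodule.mem_span_singleton.2 ⟨-c, ?_⟩
    change _ = stAut ipar opp qsgn X.1
    rw [hc, map_smul, stAut_one ipar opp_opp qsgn_mul, neg_smul, smul_neg]

/-- The diagonal Cartan subalgebra of `A(2k + s - 1, 2l + t - 1)`. -/
def aCartan : Submodule ℂ (AType k l s t) :=
  ((diagMat _).comap (sl k l s t).subtype).map (scalars k l s t).mkQ

/-- The twisting data of `A(2k + s - 1, 2l + t - 1)`. -/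
def aData (a : ℂ) (ha : a ≠ 0) (ζ : ℂ) (hζ : ζ ≠ 0) : TwistData where
  V := AType k l s t
  G := aAlg k l s t
  κ := aForm k l s t a
  κ_symm i j x y hx hy := by
    obtain ⟨X, rfl, hX⟩ := (slAlg k l s t).exists_hom_rep _ (scalars_parity k l s t) i x hx
    obtain ⟨Y, rfl, hY⟩ := (slAlg k l s t).exists_hom_rep _ (scalars_parity k l s t) j y hy
    change a * str ipar (X.1 * Y.1) = eps (i * j) * (a * str ipar (Y.1 * X.1))
    have hX' : mpar ipar X.1 = eps i • X.1 := congrArg Subtype.val hX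
    have hY' : mpar ipar Y.1 = eps j • Y.1 := congrArg Subtype.val hY
    rw [str_mul, swapMul_hom ipar hX' hY', map_smul, smul_eq_mul]
    ring
  κ_even x y := by
    obtain ⟨X, rfl⟩ := Submodule.mkQ_surjective _ x
    obtain ⟨Y, rfl⟩ := Submodule.mkQ_surjective _ y
    change a * str ipar (mpar ipar X.1 * mpar ipar Y.1) = a * str ipar (X.1 * Y.1)
    rw [← mpar_mul, str_mpar]
  κ_inv x y z := by
    obtain ⟨X, rfl⟩ := Submodule.mkQ_surjective _ x
    obtain ⟨Y, rfl⟩ := Submodule.mkQ_surjective _ y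
    obtain ⟨Z, rfl⟩ := Submodule.mkQ_surjective _ z
    exact congrArg (a * ·) (str_invariant ipar X.1 Y.1 Z.1)
  σ := aAut k l s t
  σ_br x y := by
    obtain ⟨X, rfl⟩ := Submodule.mkQ_surjective _ x
    obtain ⟨Y, rfl⟩ := Submodule.mkQ_surjective _ y
    exact congrArg (scalars k l s t).mkQ
      (Subtype.ext (stAut_br ipar opp_opp ipar_opp qsgn_mul X.1 Y.1))
  σ_parity x := by
    obtain ⟨X, rfl⟩ := Submodule.mkQ_surjective _ x
    exact congrArg (scalars k l s t).mkQ (Subtype.ext (stAut_mpar ipar ipar_opp X.1))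
  ζ := ζ
  ζ_ne := hζ
  h := aCartan k l s t
  h_even x hx := by
    obtain ⟨X, hX, rfl⟩ := hx
    exact congrArg (scalars k l s t).mkQ (Subtype.ext (mpar_diag ipar hX))
  h_nondeg x hx hσ h := by
    obtain ⟨X, hX, rfl⟩ := hx
    have hXd : X.1 ∈ diagMat _ := hX
    have hsd : ∀ {Y : Matrix (Idx k l s t) (Idx k l s t) ℂ}, Y ∈ diagMat _ →
        stAut ipar opp qsgn Y ∈ diagMat _ := by
      intro Y hY a b hab
      rw [stAut_apply, hY _ _ fun e => hab (by rw [← opp_opp a, ← e, opp_opp]), mul_zero, neg_zero]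
    have hss : ∀ {Y : Matrix (Idx k l s t) (Idx k l s t) ℂ}, Y ∈ diagMat _ →
        stAut ipar opp qsgn (stAut ipar opp qsgn Y) = Y := by
      intro Y hY
      ext a b
      by_cases hab : a = b
      · subst hab
        simp [stAut_apply, opp_opp, qsgn_mul, add_self_zmod2, eps_zero]
      · rw [hsd (hsd hY) a b hab, hY a b hab]
    -- replace `X` by a `σ`-fixed representative
    let W : sl k l s t := (2⁻¹ : ℂ) • (X + slAut k l s t X)
    have hWX : (scalars k l s t).mkQ W = (scalars k l s t).mkQ X := by
      have e : (scalars k l s t).mkQ (slAut k l s t X) = (scalars k l s t).mkQ X := hσ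
      rw [map_smul, map_add, e]; module
    have hWv : W.1 = (2⁻¹ : ℂ) • (X.1 + stAut ipar opp qsgn X.1) := rfl
    have hWd : W.1 ∈ diagMat _ := by
      rw [hWv]
      exact Submodule.smul_mem _ _ (Submodule.add_mem _ hXd (hsd hXd))
    have hWσ : stAut ipar opp qsgn W.1 = W.1 := by
      rw [hWv, map_smul, map_add, hss hXd, add_comm]
    have hW : W.1 = 0 := by
      refine diag_nondeg ipar opp_opp ipar_opp qsgn_mul hWd hWσ fun Y hY hYσ => ?_
      have hYs : str ipar Y = 0 := by
        have := str_stAut ipar opp_opp ipar_opp qsgn_mul Y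
        rw [hYσ] at this
        simpa [self_eq_neg] using this
      have := h ((scalars k l s t).mkQ ⟨Y, hYs⟩) ⟨⟨Y, hYs⟩, hY, rfl⟩
        (congrArg (scalars k l s t).mkQ (Subtype.ext hYσ))
      rw [← hWX] at this
      exact (mul_eq_zero.1 (show a * str ipar (W.1 * Y) = 0 from this)).resolve_left ha
    rw [← hWX, show W = 0 from Subtype.ext hW, map_zero]

/-- The fixed points of `X ↦ - Q⁻¹ Xˢᵗ Q`, that is, the matrices with `Xˢᵗ Q + Q X = 0`. -/
def osp : Submodule ℂ (Matrix (Idx k l s t) (Idx k l s t) ℂ) :=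
  LinearMap.eqLocus (stAut ipar opp qsgn) LinearMap.id

variable {k l s t}

lemma osp_fix {X : Matrix (Idx k l s t) (Idx k l s t) ℂ} (hX : X ∈ osp k l s t) :
    stAut ipar opp qsgn X = X := hX

/-- The diagonal entries of the reflection in the last even vector. -/
def rsgn : Idx k l 2 0 → ℂ
  | .inl (.inr (.inr i)) => if i = 1 then -1 else 1
  | _ => 1

variable (k l s t)

/-- `D(k + 1, l) = 𝔬𝔰𝔭(2k + 2 | 2l)`. -/
def dAlg : LieSuperalgebra (osp k l 2 0) :=
  (gl ipar).sub (osp k l 2 0)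
    (fun X hX => by
      change stAut ipar opp qsgn (mpar ipar X) = mpar ipar X
      rw [stAut_mpar ipar ipar_opp, osp_fix hX])
    (fun X hX Y hY => by
      change stAut ipar opp qsgn _ = _
      rw [stAut_br ipar opp_opp ipar_opp qsgn_mul, osp_fix hX, osp_fix hY]; rfl)

lemma rsgn_mul (a : Idx k l 2 0) : rsgn a * rsgn a = 1 := by
  rcases a with (_ | _ | i) | (_ | _ | i)
  · simp [rsgn]
  · simp [rsgn]
  · simp only [rsgn]; split_ifs <;> norm_num
  · simp [rsgn]
  · simp [rsgn]
  · exact i.elim0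

lemma rsgn_opp (a : Idx k l 2 0) : rsgn (opp a) = rsgn a := by
  rcases a with (_ | _ | i) | (_ | _ | i) <;> rfl

/-- Conjugation by the reflection in the last even vector. -/
def reflMat : Matrix (Idx k l 2 0) (Idx k l 2 0) ℂ →ₗ[ℂ] Matrix (Idx k l 2 0) (Idx k l 2 0) ℂ where
  toFun X := Matrix.of fun a b => rsgn a * rsgn b * X a b
  map_add' X Y := by ext a b; simp [mul_add]
  map_smul' c X := by ext a b; simp [mul_left_comm]

lemma reflMat_apply (X : Matrix (Idx k l 2 0) (Idx k l 2 0) ℂ) (a b : Idx k l 2 0) :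
    reflMat k l X a b = rsgn a * rsgn b * X a b := rfl

lemma reflMat_mul (X Y : Matrix (Idx k l 2 0) (Idx k l 2 0) ℂ) :
    reflMat k l (X * Y) = reflMat k l X * reflMat k l Y := by
  ext a b
  simp only [reflMat_apply, Matrix.mul_apply, Finset.mul_sum]
  refine Finset.sum_congr rfl fun c _ => ?_
  linear_combination (-(rsgn a * rsgn b * (X a c * Y c b))) * rsgn_mul k l c

lemma reflMat_mpar (X : Matrix (Idx k l 2 0) (Idx k l 2 0) ℂ) :
    reflMat k l (mpar ipar X) = mpar ipar (reflMat k l X) := by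
  ext a b; simp only [reflMat_apply, mpar_apply]; ring

lemma reflMat_stAut (X : Matrix (Idx k l 2 0) (Idx k l 2 0) ℂ) :
    stAut ipar opp qsgn (reflMat k l X) = reflMat k l (stAut ipar opp qsgn X) := by
  ext a b; simp only [reflMat_apply, stAut_apply, rsgn_opp]; ring

lemma reflMat_br (X Y : Matrix (Idx k l 2 0) (Idx k l 2 0) ℂ) :
    reflMat k l ((gl ipar).br X Y) = (gl ipar).br (reflMat k l X) (reflMat k l Y) := by
  simp only [gl_br, swapMul_def, map_sub, map_smul, map_add, reflMat_mul, reflMat_mpar]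

/-- The automorphism of order `2` of `𝔬𝔰𝔭(2k + 2 | 2l)`: conjugation by a reflection of the even
part. -/
def dAut : osp k l 2 0 →ₗ[ℂ] osp k l 2 0 :=
  (reflMat k l).restrict (p := osp k l 2 0) (q := osp k l 2 0) fun X hX => by
    change stAut ipar opp qsgn (reflMat k l X) = reflMat k l X
    rw [reflMat_stAut, osp_fix hX]

/-- The Cartan subalgebra of `𝔬𝔰𝔭(2k + 2 | 2l)`: the only nonzero entries off the diagonal are
among those of the rotations of the plane spanned by the two even vectors of weight `0`. -/
def dCartan : Submodule ℂ (osp k l 2 0) where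
  carrier := {X | ∀ a b, a ≠ b →
    (¬ ∃ i j, a = .inl (.inr (.inr i)) ∧ b = .inl (.inr (.inr j))) → X.1 a b = 0}
  add_mem' := by intro X Y hX hY a b h h'; simp [hX a b h h', hY a b h h']
  zero_mem' := fun _ _ _ _ => rfl
  smul_mem' := by intro c X hX a b h h'; simp [hX a b h h']

/-- The twisting data of `D(k + 1, l)`. -/
def dData (a : ℂ) (ha : a ≠ 0) (ζ : ℂ) (hζ : ζ ≠ 0) : TwistData where
  V := osp k l 2 0
  G := dAlg k l
  κ := (a • strForm ipar).domRestrict₁₂ (osp k l 2 0) (osp k l 2 0)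
  κ_symm i j X Y hX hY := by
    change a * str ipar (X.1 * Y.1) = eps (i * j) * (a * str ipar (Y.1 * X.1))
    have hX' : mpar ipar X.1 = eps i • X.1 := congrArg Subtype.val hX
    have hY' : mpar ipar Y.1 = eps j • Y.1 := congrArg Subtype.val hY
    rw [str_mul, swapMul_hom ipar hX' hY', map_smul, smul_eq_mul]
    ring
  κ_even X Y := by
    change a * str ipar (mpar ipar X.1 * mpar ipar Y.1) = a * str ipar (X.1 * Y.1)
    rw [← mpar_mul, str_mpar]
  κ_inv X Y Z := congrArg (a * ·) (str_invariant ipar X.1 Y.1 Z.1)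
  σ := dAut k l
  σ_br X Y := Subtype.ext (reflMat_br k l X.1 Y.1)
  σ_parity X := Subtype.ext (reflMat_mpar k l X.1)
  ζ := ζ
  ζ_ne := hζ
  h := dCartan k l
  h_even X hX := by
    refine Subtype.ext ?_
    change mpar ipar X.1 = X.1
    ext a b
    rw [mpar_apply]
    by_cases hab : a = b
    · subst hab; simp [add_self_zmod2, eps_zero]
    · by_cases h : ∃ i j, a = .inl (.inr (.inr i)) ∧ b = .inl (.inr (.inr j))
      · obtain ⟨i, j, rfl, rfl⟩ := h
        simp [ipar, eps_zero]
      · rw [hX a b hab h, mul_zero]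
  h_nondeg X hX hσ h := by
    have hd : X.1 ∈ diagMat _ := by
      intro a b hab
      by_cases h : ∃ i j, a = .inl (.inr (.inr i)) ∧ b = .inl (.inr (.inr j))
      · obtain ⟨i, j, rfl, rfl⟩ := h
        have hij : i ≠ j := fun e => hab (by rw [e])
        have e : reflMat k l X.1 = X.1 := congrArg Subtype.val hσ
        have := congrFun (congrFun e (.inl (.inr (.inr i)))) (.inl (.inr (.inr j)))
        rw [reflMat_apply] at this
        fin_cases i <;> fin_cases j <;> simp [rsgn] at this hij ⊢ <;>
          linear_combination (-1 / 2 : ℂ) * this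
      · exact hX a b hab h
    refine Subtype.ext (diag_nondeg ipar opp_opp ipar_opp qsgn_mul hd X.2 fun Y hY hYσ => ?_)
    have hYr : reflMat k l Y = Y := by
      ext a b
      rw [reflMat_apply]
      by_cases hab : a = b
      · subst hab; rw [rsgn_mul, one_mul]
      · rw [hY a b hab, mul_zero]
    have := h ⟨Y, hYσ⟩ (fun a b hab _ => hY a b hab) (Subtype.ext hYr)
    exact (mul_eq_zero.1 (show a * str ipar (X.1 * Y) = 0 from this)).resolve_left ha

end Types

/-- The types of twisted affine Lie superalgebras with nonzero odd part. -/
inductive TwistedType : Type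
  /-- `A(2k, 2l - 1)⁽²⁾`. -/
  | AEvenOdd (k l : ℕ) (hl : 1 ≤ l)
  /-- `A(2k - 1, 2l - 1)⁽²⁾`, `(k, l) ≠ (1, 1)`. -/
  | AOddOdd (k l : ℕ) (hk : 1 ≤ k) (hl : 1 ≤ l) (hkl : ¬ (k = 1 ∧ l = 1))
  /-- `A(2k, 2l)⁽⁴⁾`. -/
  | AEvenEven (k l : ℕ) (hl : 1 ≤ l)
  /-- `D(k + 1, l)⁽²⁾`. -/
  | D (k l : ℕ) (hl : 1 ≤ l)

/-- The order `n` of the automorphism `σ`. -/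
def TwistedType.order : TwistedType → ℕ
  | .AEvenEven _ _ _ => 4
  | _ => 2

/-- The twisted affine Lie superalgebra of the given type. The invariant form `κ` of the
underlying finite-dimensional simple Lie superalgebra is unique up to a nonzero scalar; here it is
`a` times the supertrace form. The root of unity `ζ` enters `σ x = ζ ^ j x` on `[j]𝔤`. -/
def TwistedType.data (T : TwistedType) (a : ℂ) (ha : a ≠ 0) (ζ : ℂ) (hζ : ζ ≠ 0) : TwistData :=
  match T with
  | .AEvenOdd k l _ => aData k l 1 0 a ha ζ hζ
  | .AOddOdd k l _ _ _ => aData k l 0 0 a ha ζ hζ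
  | .AEvenEven k l _ => aData k l 1 1 a ha ζ hζ
  | .D k l _ => dData k l a ha ζ hζ

end

end TwistedAffine

open TwistedAffine

namespace TwistedAffine

set_option linter.unusedSectionVars false

/-! ### Root spaces of a twisted affinization -/

section Loop

variable {V : Type} [AddCommGroup V] [Module ℂ V]

/-! Choose an even root vector `e` for `α` and an opposite root vector `f` for `-α` with `(e, f) ≠
0` and `h = [e, f]` in the Cartan subalgebra. Invariance gives `h = (e, f) t_α`, so `α(h) ≠ 0`,
every `β_i(h)` is zero, and `e`, `f`, `h` span a rank one simple Lie algebra. Since `α ± β_i` are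
not roots, the product `X` of one homogeneous root vector for each `β_i` commutes with `e` and `f`.
It therefore commutes with the Casimir operator, and it is injective.

From a vector of weight `μ + s_n α + (s_n + 1) ∑ β_i`, local nilpotency of `e` produces a vector
killed by `e`, of weight `μ + k_n α + (s_n + 1) ∑ β_i` with `k_n ≥ s_n`. Applying `f ^ k_n` and then
a suitable power of `X` moves all these vectors into the single weight space of `μ + Q ∑ β_i`. They
stay nonzero because `f` and `X` are injective, and they keep their Casimir eigenvalue, which is
quadratic in `k_n`. Large distinct `k_n` give distinct eigenvalues, so any number of independent
vectors can be placed in one weight space (`SuperModule.not_bounded`).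

The structural input is the existence of `f` (`TwistData.HasOpposites`,
`HasOpposites.exists_rootSpace_neg`). On matrices a signed conjugate transpose `dag` does this. It
turns the supertrace form into a positive definite Hermitian form, reverses weights, commutes with
the twisting automorphism, and, being antilinear, sends the `ζ ^ p`-eigenspace to the `ζ ^
(-p)`-eigenspace. The same input shows that `-α + β_i` is not a root when `α - β_i` is not. -/

lemma loopDeg_apply (x : ℤ →₀ V) (p : ℤ) : loopDeg x p = (p : ℂ) • x p := by
  induction x using Finsupp.induction_linear with
  | zero => simp
  | add x y hx hy => simp only [map_add, Finsupp.add_apply, hx, hy, smul_add]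
  | single q v =>
    rw [loopDeg_single]
    by_cases h : p = q
    · subst h; simp
    · simp [Finsupp.single_eq_of_ne h]

end Loop

/-! ### Homogeneous components -/

lemma LieSuperalgebra.mem_part {V : Type*} [AddCommGroup V] [Module ℂ V]
    (G : LieSuperalgebra V) {i : ZMod 2} {x : V} : x ∈ G.part i ↔ G.parity x = eps i • x :=
  Iff.rfl

/-- The two parity projections of `x` add up to `2 x`, so they cannot both vanish. -/
lemma LieSuperalgebra.exists_projection_ne_zero {V : Type*} [AddCommGroup V] [Module ℂ V]
    (G : LieSuperalgebra V) {x : V} (hx : x ≠ 0) :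
    ∃ i : ZMod 2, x + eps i • G.parity x ∈ G.part i ∧ x + eps i • G.parity x ≠ 0 := by
  have hm : ∀ i : ZMod 2, x + eps i • G.parity x ∈ G.part i := fun i => by
    rw [G.mem_part, map_add, map_smul, G.parity_parity, smul_add, smul_smul, eps_mul_self,
      one_smul, add_comm]
  by_contra! h
  have h0 := h 0 (hm 0)
  have h1 := h 1 (hm 1)
  rw [eps_zero, one_smul] at h0
  rw [eps_one, neg_smul, one_smul] at h1
  refine hx ?_
  have : (2 : ℂ) • x = (x + G.parity x) + (x + -G.parity x) := by module
  rw [h0, h1, add_zero] at this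
  exact (smul_eq_zero.1 this).resolve_left two_ne_zero

/-! ### Root vectors as homogeneous loops -/

namespace TwistData

variable (D : TwistData)

/-- The element `v ⊗ t ^ p` of the twisted affinization. -/
noncomputable def homog (p : ℤ) (v : D.V) (hv : D.σ v = D.ζ ^ p • v) : D.L :=
  ⟨(Finsupp.single p v, 0, 0), D.single_mem_loop hv⟩

/-- The element `w ⊗ 1 + r c + s d` of the Cartan subalgebra. -/
noncomputable def cartanElt (w : D.V) (hw : w ∈ D.h) (hσ : D.σ w = w) (r s : ℂ) : D.hh :=
  ⟨⟨(Finsupp.single 0 w, r, s), D.single_mem_loop (by simp [hσ])⟩,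
    fun p hp => by simp [hp], by simpa using hw⟩

lemma cartanElt_add (w : D.V) (hw : w ∈ D.h) (hσ : D.σ w = w) (r s : ℂ) :
    D.cartanElt w hw hσ r s = D.cartanElt w hw hσ 0 0 +
      r • D.cartanElt 0 D.h.zero_mem (map_zero _) 1 0 +
      s • D.cartanElt 0 D.h.zero_mem (map_zero _) 0 1 := by
  refine Subtype.ext (Subtype.ext (Prod.ext ?_ (Prod.ext ?_ ?_)))
  all_goals simp [cartanElt]

lemma hh_fixed (T : D.hh) : D.σ (T.1.1.1 0) = T.1.1.1 0 := by
  simpa using T.1.2 0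

lemma hh_eq_cartanElt (T : D.hh) :
    T = D.cartanElt (T.1.1.1 0) T.2.2 (D.hh_fixed T) T.1.1.2.1 T.1.1.2.2 :=
  Subtype.ext (Subtype.ext (Prod.ext (D.hh_eq_single T) rfl))

lemma lie_br_val (x y : D.L) : (D.lie.br x y).1 = affineBr D.G D.κ x.1 y.1 := rfl

lemma lie_parity_val (x : D.L) : (D.lie.parity x).1 = (loopPar D.G x.1.1, x.1.2) := rfl

/-- Elements of the Cartan subalgebra have loop degree zero, so the degree derivation kills them.
This removes the central cocycle and the contribution of the `d`-coordinate of `x`. -/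
lemma hh_br_val (T : D.hh) (x : D.L) : (D.lie.br T x).1 =
    (loopBr D.G (Finsupp.single 0 (T.1.1.1 0)) x.1.1 + T.1.1.2.2 • loopDeg x.1.1, 0, 0) := by
  obtain ⟨⟨x, r, s⟩, hx⟩ := x
  have e : T.1.1 = (Finsupp.single 0 (T.1.1.1 0), T.1.1.2.1, T.1.1.2.2) :=
    Prod.ext (D.hh_eq_single T) rfl
  rw [lie_br_val, e, affineBr_apply, loopDeg_single]
  simp

lemma parity_hh (T : D.hh) : (T : D.L) ∈ D.lie.part 0 := by
  rw [LieSuperalgebra.mem_part, eps_zero, one_smul]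
  refine Subtype.ext ?_
  rw [lie_parity_val]
  refine Prod.ext ?_ rfl
  change loopPar D.G T.1.1.1 = T.1.1.1
  rw [D.hh_eq_single T, loopPar_single, D.h_even _ T.2.2]

lemma mem_rootSpace {γ : D.HDual} {x : D.L} :
    x ∈ D.rootSpace γ ↔ ∀ T : D.hh, D.lie.br T x = γ T • x := Iff.rfl

lemma homog_mem_rootSpace {γ : D.HDual} {p : ℤ} {v : D.V} {hv : D.σ v = D.ζ ^ p • v} :
    D.homog p v hv ∈ D.rootSpace γ ↔ ∀ T : D.hh,
      D.G.br (T.1.1.1 0) v + (T.1.1.2.2 * p) • v = γ T • v := by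
  rw [mem_rootSpace]
  refine forall_congr' fun T => ?_
  rw [Subtype.ext_iff, hh_br_val]
  simp only [homog, loopBr_single, loopDeg_single, zero_add, Finsupp.smul_single,
    ← Finsupp.single_add, Submodule.coe_smul, Prod.smul_mk, smul_zero, Prod.mk.injEq, and_true,
    smul_smul]
  exact ⟨fun h => Finsupp.single_injective _ h, fun h => by rw [h]⟩

lemma homog_parity {i : ZMod 2} {p : ℤ} {v : D.V} {hv : D.σ v = D.ζ ^ p • v} :
    D.homog p v hv ∈ D.lie.part i ↔ D.G.parity v = eps i • v := by
  rw [LieSuperalgebra.mem_part, Subtype.ext_iff, lie_parity_val]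
  simp only [homog, loopPar_single, Submodule.coe_smul, Prod.smul_mk, Finsupp.smul_single,
    Prod.mk.injEq, smul_zero]
  exact ⟨fun h => Finsupp.single_injective _ h.1, fun h => ⟨by rw [h], trivial⟩⟩

/-- The element `d` acts on the coefficient of `t ^ q` by `q`, so a root vector lives in one loop
degree. Brackets with the Cartan subalgebra have no `c` or `d` component, and `γ ≠ 0` then forces
these components of `x` to vanish. -/
lemma exists_homog {γ : D.HDual} (hγ : γ ≠ 0) {x : D.L} (hx : x ∈ D.rootSpace γ) (hx0 : x ≠ 0) :
    ∃ p v hv, x = D.homog p v hv ∧ v ≠ 0 := by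
  rw [mem_rootSpace] at hx
  obtain ⟨T, hT⟩ : ∃ T, γ T ≠ 0 := by
    by_contra! h
    exact hγ (LinearMap.ext h)
  have hcd : x.1.2 = 0 := by
    have := congrArg (fun z : D.L => z.1.2) (hx T)
    simp only [hh_br_val, Submodule.coe_smul, Prod.smul_snd] at this
    exact (smul_eq_zero.1 this.symm).resolve_left hT
  have hx1 : x.1.1 ≠ 0 := fun h => hx0 (Subtype.ext (Prod.ext h hcd))
  obtain ⟨p, hp⟩ := Finsupp.ne_iff.1 hx1
  have hd : ∀ q : ℤ, (q : ℂ) • x.1.1 q = γ (D.cartanElt 0 D.h.zero_mem (map_zero _) 0 1) • x.1.1 q := by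
    intro q
    have := congrArg (fun z : D.L => z.1.1 q) (hx (D.cartanElt 0 D.h.zero_mem (map_zero _) 0 1))
    rw [hh_br_val] at this
    simpa [cartanElt, loopDeg_apply] using this
  have hpd : (p : ℂ) = γ (D.cartanElt 0 D.h.zero_mem (map_zero _) 0 1) :=
    smul_left_injective ℂ hp (hd p)
  refine ⟨p, x.1.1 p, x.2 p, Subtype.ext (Prod.ext ?_ hcd), hp⟩
  ext q
  change x.1.1 q = Finsupp.single p (x.1.1 p) q
  by_cases hq : q = p
  · subst hq; simp
  · rw [Finsupp.single_eq_of_ne hq]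
    have := hd q
    rw [← hpd, ← sub_eq_zero, ← sub_smul] at this
    refine (smul_eq_zero.1 this).resolve_left (sub_ne_zero.2 ?_)
    exact_mod_cast hq

lemma root_central {γ : D.HDual} (hγ : γ ∈ D.R) :
    γ (D.cartanElt 0 D.h.zero_mem (map_zero _) 1 0) = 0 := by
  obtain ⟨x, hx, hx0⟩ := Submodule.exists_mem_ne_zero_of_ne_bot hγ
  have : D.lie.br (D.cartanElt 0 D.h.zero_mem (map_zero _) 1 0 : D.hh) x = 0 :=
    Subtype.ext (by rw [hh_br_val]; simp [cartanElt])
  rw [D.mem_rootSpace.1 hx] at this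
  exact (smul_eq_zero.1 this).resolve_right hx0

/-! ### The transferred form and opposite root vectors -/

/-- The element of the Cartan subalgebra representing a functional through the invariant form. -/
noncomputable def tElt (α : D.HDual) : D.hh := (D.hForm.toDual D.hForm_nondegenerate).symm α

lemma hForm_tElt (α : D.HDual) (T : D.hh) : D.hForm (D.tElt α) T = α T := by
  have := LinearMap.BilinForm.toDual_def (B := D.hForm) D.hForm_nondegenerate (m := D.tElt α) (n := T)
  rw [← this, tElt, LinearEquiv.apply_symm_apply]

lemma dualForm_eq (α γ : D.HDual) : D.dualForm α γ = α (D.tElt γ) := D.hForm_tElt α _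

lemma dualForm_comm (α γ : D.HDual) : D.dualForm α γ = D.dualForm γ α := D.hForm_symm _ _

/-- A functional vanishing on the centre which is not orthogonal to a root is nonzero on the
finite part of the Cartan subalgebra. -/
lemma exists_cartan_ne_zero {α γ : D.HDual} (hα : α ∈ D.R) (hγ : γ ∈ D.R)
    (h : D.dualForm γ α ≠ 0) :
    ∃ w, ∃ hw : w ∈ D.h, ∃ hσ : D.σ w = w, γ (D.cartanElt w hw hσ 0 0) ≠ 0 := by
  refine ⟨_, (D.tElt α).2.2, D.hh_fixed _, ?_⟩
  -- The `d`-coordinate of `t_α` is its pairing with `c`, namely `α(c) = 0`. Together with `γ(c) =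
  -- 0`, only the finite part of `t_α` contributes to `(γ, α)`.
  have hs : (D.tElt α).1.1.2.2 = 0 := by
    have := D.hForm_tElt α (D.cartanElt 0 D.h.zero_mem (map_zero _) 1 0)
    rw [D.root_central hα, hForm_apply] at this
    simpa [cartanElt] using this
  rw [dualForm_eq, D.hh_eq_cartanElt (D.tElt α), cartanElt_add, map_add, map_add, map_smul,
    map_smul, D.root_central hγ, hs] at h
  simpa using h

/-- Every homogeneous weight vector of `𝔤` of nonzero weight has an opposite weight vector, not
orthogonal to it, such that their bracket lies in the Cartan subalgebra. -/
def HasOpposites : Prop :=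
  ∀ (i : ZMod 2) (p : ℤ) (x : D.V) (φ : D.V → ℂ), x ≠ 0 → D.G.parity x = eps i • x →
    D.σ x = D.ζ ^ p • x → (∀ w ∈ D.h, D.σ w = w → D.G.br w x = φ w • x) →
    (∃ w ∈ D.h, D.σ w = w ∧ φ w ≠ 0) →
    ∃ y, D.G.parity y = eps i • y ∧ D.σ y = D.ζ ^ (-p) • y ∧
      (∀ w ∈ D.h, D.σ w = w → D.G.br w y = -φ w • y) ∧ D.κ x y ≠ 0 ∧ D.G.br x y ∈ D.h

lemma form_apply (x y : D.L) : D.form x y =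
    loopForm D.κ x.1.1 y.1.1 + x.1.2.1 * y.1.2.2 + x.1.2.2 * y.1.2.1 := rfl

lemma form_homog (p : ℤ) (x y : D.V) (hx : D.σ x = D.ζ ^ p • x) (hy : D.σ y = D.ζ ^ (-p) • y) :
    D.form (D.homog p x hx) (D.homog (-p) y hy) = D.κ x y := by
  simp [form_apply, homog, loopForm_single]

variable {D}

/-- Non-orthogonality to a root makes `γ` nonzero on the finite part of the Cartan subalgebra, which
is what `HasOpposites` requires of the weight. Placing the opposite vector in loop degree `-p`
reverses the eigenvalue of `d` too; the bracket then has degree zero, and its central term already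
lies in the Cartan subalgebra. -/
lemma HasOpposites.exists_rootSpace_neg (hD : D.HasOpposites) {α γ : D.HDual} (hα : α ∈ D.R)
    (h : D.dualForm γ α ≠ 0) {i : ZMod 2} {x : D.L} (hx : x ∈ D.rootSpace γ) (hx0 : x ≠ 0)
    (hxi : x ∈ D.lie.part i) :
    ∃ y ∈ D.rootSpace (-γ), y ∈ D.lie.part i ∧ D.form x y ≠ 0 ∧ D.lie.br x y ∈ D.hh := by
  have hγ : γ ∈ D.R := fun e => hx0 ((Submodule.mem_bot ℂ).1 (e ▸ hx))
  have hγ0 : γ ≠ 0 := by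
    rintro rfl
    exact h (by rw [dualForm_eq, LinearMap.zero_apply])
  obtain ⟨w, hw, hσ, hne⟩ := D.exists_cartan_ne_zero hα hγ h
  obtain ⟨p, v, hv, rfl, hv0⟩ := D.exists_homog hγ0 hx hx0
  rw [homog_mem_rootSpace] at hx
  classical
  -- `HasOpposites` takes a weight defined on all of `𝔤`; the value zero outside the fixed Cartan
  -- elements is never consulted.
  let φ : D.V → ℂ := fun w => if hw : w ∈ D.h ∧ D.σ w = w then
    γ (D.cartanElt w hw.1 hw.2 0 0) else 0
  have hφ : ∀ w (hw : w ∈ D.h) (hσ : D.σ w = w), φ w = γ (D.cartanElt w hw hσ 0 0) :=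
    fun w hw hσ => dif_pos ⟨hw, hσ⟩
  have hφx : ∀ w ∈ D.h, D.σ w = w → D.G.br w v = φ w • v := by
    intro w hw hσ
    have := hx (D.cartanElt w hw hσ 0 0)
    rw [hφ w hw hσ, ← this]
    simp [cartanElt]
  obtain ⟨y, hyi, hyσ, hyφ, hκ, hbr⟩ := hD i p v φ hv0 (D.homog_parity.1 hxi) hv hφx
    ⟨w, hw, hσ, by rwa [hφ w hw hσ]⟩
  refine ⟨D.homog (-p) y hyσ, ?_, D.homog_parity.2 hyi, ?_, ?_⟩
  · rw [homog_mem_rootSpace]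
    intro T
    have hT := hx T
    rw [hφx _ T.2.2 (D.hh_fixed T), ← add_smul] at hT
    have hT' := smul_left_injective ℂ hv0 hT
    replace hT' : _ = γ T := hT'
    rw [hyφ _ T.2.2 (D.hh_fixed T), ← add_smul, LinearMap.neg_apply, ← hT']
    push_cast
    congr 1
    ring
  · rwa [form_homog]
  · have e : (D.lie.br (D.homog p v hv) (D.homog (-p) y hyσ)).1.1 =
        Finsupp.single 0 (D.G.br v y) := by
      rw [lie_br_val, homog, homog, affineBr_apply, loopBr_single]
      simp
    refine ⟨fun q hq => ?_, ?_⟩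
    · rw [e, Finsupp.single_eq_of_ne hq]
    · rw [e]; simpa using hbr

/-- The Cartan subalgebra is even, so its action commutes with the parity involution. -/
lemma parity_mem_rootSpace {γ : D.HDual} {x : D.L} (hx : x ∈ D.rootSpace γ) :
    D.lie.parity x ∈ D.rootSpace γ := by
  rw [mem_rootSpace] at hx ⊢
  intro T
  have hT : D.lie.parity T = (T : D.L) := by
    have := D.parity_hh T
    rwa [LieSuperalgebra.mem_part, eps_zero, one_smul] at this
  rw [← map_smul, ← hx T, D.lie.parity_br, hT]

/-- The Jacobi identity and the module rule carry signs and are stated for homogeneous elements, so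
root vectors have to be chosen homogeneous. -/
lemma exists_homogeneous_of_mem_R {γ : D.HDual} (hγ : γ ∈ D.R) :
    ∃ i : ZMod 2, ∃ x ∈ D.rootSpace γ, x ∈ D.lie.part i ∧ x ≠ 0 := by
  obtain ⟨x, hx, hx0⟩ := Submodule.exists_mem_ne_zero_of_ne_bot hγ
  obtain ⟨i, hi, h0⟩ := D.lie.exists_projection_ne_zero hx0
  exact ⟨i, _, Submodule.add_mem _ hx (Submodule.smul_mem _ _ (parity_mem_rootSpace hx)), hi, h0⟩

/-- The opposite vector pairs nontrivially with the given one, hence is nonzero. -/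
lemma HasOpposites.neg_mem_R (hD : D.HasOpposites) {α γ : D.HDual} (hα : α ∈ D.R)
    (h : D.dualForm γ α ≠ 0) (hγ : γ ∈ D.R) : -γ ∈ D.R := by
  obtain ⟨i, x, hx, hi, hx0⟩ := exists_homogeneous_of_mem_R hγ
  obtain ⟨y, hy, -, hxy, -⟩ := hD.exists_rootSpace_neg hα h hx hx0 hi
  intro e
  rw [e, Submodule.mem_bot] at hy
  exact hxy (by rw [hy, map_zero])

lemma br_mem_rootSpace {γ δ : D.HDual} {x y : D.L} {i : ZMod 2} (hx : x ∈ D.rootSpace γ)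
    (hxi : x ∈ D.lie.part i) (hy : y ∈ D.rootSpace δ) : D.lie.br x y ∈ D.rootSpace (γ + δ) := by
  rw [mem_rootSpace] at hx hy ⊢
  intro T
  rw [D.lie.jacobi 0 i T x y (D.parity_hh T) hxi, hx, hy, zero_mul, eps_zero, one_smul,
    map_smul, map_smul, LinearMap.smul_apply, ← add_smul, LinearMap.add_apply]

lemma br_eq_zero {γ δ : D.HDual} {x y : D.L} {i : ZMod 2} (hx : x ∈ D.rootSpace γ)
    (hxi : x ∈ D.lie.part i) (hy : y ∈ D.rootSpace δ) (h : γ + δ ∉ D.R) :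
    D.lie.br x y = 0 := by
  have := br_mem_rootSpace hx hxi hy
  rwa [not_not.1 h, Submodule.mem_bot] at this

/-- The contributions of `c` and `d` match because the degree derivation is skew for the loop form.
-/
lemma form_inv (x y z : D.L) : D.form (D.lie.br x y) z = D.form x (D.lie.br y z) := by
  obtain ⟨⟨x, r, s⟩, hx⟩ := x
  obtain ⟨⟨y, r', s'⟩, hy⟩ := y
  obtain ⟨⟨z, r'', s''⟩, hz⟩ := z
  rw [form_apply, form_apply, lie_br_val, lie_br_val, affineBr_apply, affineBr_apply]
  simp only [map_add, map_sub, map_smul, LinearMap.add_apply, LinearMap.sub_apply,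
    LinearMap.smul_apply, smul_eq_mul, loopForm_inv D.G D.κ_inv, loopForm_deg]
  ring

/-- The bracket of opposite root vectors is proportional to the coroot. -/
lemma apply_br {α γ : D.HDual} {x y : D.L} {i : ZMod 2} (hyi : y ∈ D.lie.part i)
    (hy : y ∈ D.rootSpace (-α)) (h : D.lie.br x y ∈ D.hh) :
    γ ⟨D.lie.br x y, h⟩ = D.form x y * D.dualForm α γ := by
  -- `γ([x, y]) = ([x, y], t_γ) = (x, [y, t_γ])`, and `y` has weight `-α`.
  rw [dualForm_eq, ← hForm_tElt, hForm_symm]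
  change D.form (D.lie.br x y) (D.tElt γ) = _
  rw [form_inv, D.lie.skew i 0 y _ hyi (D.parity_hh _), D.mem_rootSpace.1 hy, mul_zero, eps_zero,
    one_smul]
  have e : -((-α) (D.tElt γ) • y) = α (D.tElt γ) • y := by
    rw [LinearMap.neg_apply]
    module
  rw [e, map_smul, smul_eq_mul, mul_comm]

end TwistData

/-! ### Opposite weight vectors in matrix superalgebras -/

lemma conj_eps (i : ZMod 2) : (starRingEnd ℂ) (eps i) = eps i := by
  rcases zmod2 i with rfl | rfl <;> simp [eps]

section Matrices

variable {I : Type} [Fintype I] [DecidableEq I] (p : I → ZMod 2)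

/-- The conjugate transpose followed by the sign change of the odd columns. -/
noncomputable def dag (X : Matrix I I ℂ) : Matrix I I ℂ :=
  Matrix.of fun a b => eps (p b) * (starRingEnd ℂ) (X b a)

lemma dag_apply (X : Matrix I I ℂ) (a b : I) :
    dag p X a b = eps (p b) * (starRingEnd ℂ) (X b a) := rfl

lemma dag_smul (z : ℂ) (X : Matrix I I ℂ) : dag p (z • X) = (starRingEnd ℂ) z • dag p X := by
  ext a b
  simp only [dag_apply, Matrix.smul_apply, smul_eq_mul, map_mul]
  ring

lemma mpar_dag {i : ZMod 2} {X : Matrix I I ℂ} (hX : mpar p X = eps i • X) :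
    mpar p (dag p X) = eps i • dag p X := by
  rw [← conj_eps i, ← dag_smul, ← hX]
  ext a b
  simp only [mpar_apply, dag_apply, map_mul, conj_eps, add_comm (p b)]
  ring

/-- The signs of the supertranspose and of `dag` agree by an identity between parities, and `q` is
real. Since `dag` is antilinear, it therefore exchanges the eigenspaces of conjugate eigenvalues. -/
lemma stAut_dag {ι : I → I} {q : I → ℂ} (hp : ∀ a, p (ι a) = p a)
    (hq : ∀ a, (starRingEnd ℂ) (q a) = q a) (X : Matrix I I ℂ) :
    stAut p ι q (dag p X) = dag p (stAut p ι q X) := by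
  ext a b
  simp only [stAut_apply, dag_apply, hp, map_mul, map_neg, hq, conj_eps]
  have h : eps (p a * (p a + p b)) * eps (p a) = eps (p b) * eps (p b * (p b + p a)) := by
    rw [← eps_add, ← eps_add]
    congr 1
    generalize p a = i; generalize p b = j
    revert i j; decide
  linear_combination (-(q (ι a) * q (ι b) * (starRingEnd ℂ) (X (ι a) (ι b)))) * h

/-- The column sign in `dag` cancels the sign of the supertrace, leaving `∑ |X a b| ^ 2`. -/
lemma str_mul_dag_ne_zero {X : Matrix I I ℂ} (hX : X ≠ 0) : str p (X * dag p X) ≠ 0 := by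
  intro h
  have e : ∑ a, ∑ b, Complex.normSq (X a b) = 0 := by
    have : ((∑ a, ∑ b, Complex.normSq (X a b) : ℝ) : ℂ) = 0 := by
      rw [← h]
      simp only [str_apply, Matrix.mul_apply, dag_apply, Finset.mul_sum]
      push_cast
      refine Finset.sum_congr rfl fun a _ => Finset.sum_congr rfl fun b _ => ?_
      rw [← Complex.mul_conj]
      linear_combination (-(X a b * (starRingEnd ℂ) (X a b))) * eps_mul_self (p a)
    exact_mod_cast this
  refine hX (Matrix.ext fun a b => ?_)
  have ha := (Finset.sum_eq_zero_iff_of_nonneg fun a _ =>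
    Finset.sum_nonneg fun b _ => Complex.normSq_nonneg (X a b)).1 e a (Finset.mem_univ a)
  exact Complex.normSq_eq_zero.1 ((Finset.sum_eq_zero_iff_of_nonneg
    fun b _ => Complex.normSq_nonneg (X a b)).1 ha b (Finset.mem_univ b))

lemma gl_br_diag_apply {W : Matrix I I ℂ} (hW : W ∈ diagMat I) (X : Matrix I I ℂ) (a b : I) :
    (gl p).br W X a b = (W a a - W b b) * X a b := by
  rw [gl_br, swapMul_even p (mpar_diag p hW), Matrix.sub_apply, Matrix.mul_apply,
    Matrix.mul_apply, Finset.sum_eq_single a, Finset.sum_eq_single b]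
  · ring
  · intro c _ hc; rw [hW c b hc, mul_zero]
  · simp
  · intro c _ hc; rw [hW a c hc.symm, zero_mul]
  · simp

/-- A nonzero entry at `(b, a)` forces `c = w b - w a`, and transposing positions reverses this
difference. The weight is read off from positions, so it is negated but not conjugated. -/
lemma dag_weight {w : I → ℂ} {c : ℂ} {X : Matrix I I ℂ}
    (h : ∀ a b, (w a - w b) * X a b = c * X a b) (a b : I) :
    (w a - w b) * dag p X a b = -c * dag p X a b := by
  by_cases hX : X b a = 0
  · simp [dag_apply, hX]
  · rw [← mul_right_cancel₀ hX (h b a)]; ring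

lemma gl_br_diag_dag {W X : Matrix I I ℂ} {c : ℂ} (hW : W ∈ diagMat I)
    (h : (gl p).br W X = c • X) : (gl p).br W (dag p X) = -c • dag p X := by
  ext a b
  rw [gl_br_diag_apply p hW, Matrix.smul_apply, smul_eq_mul]
  refine dag_weight p (w := fun a => W a a) (fun a b => ?_) a b
  rw [← gl_br_diag_apply p hW, h, Matrix.smul_apply, smul_eq_mul]

/-- Each summand of the two products pairs an entry of weight `c` with one of weight `-c`, so the
bracket has weight zero and is supported where the weights of row and column coincide. -/
lemma gl_br_dag_weight {w : I → ℂ} {c : ℂ} {X : Matrix I I ℂ}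
    (h : ∀ a b, (w a - w b) * X a b = c * X a b) (a b : I) :
    (w a - w b) * (gl p).br X (dag p X) a b = 0 := by
  have h' := dag_weight p h
  rw [gl_br, Matrix.sub_apply, swapMul_apply, Matrix.mul_apply, ← Finset.sum_sub_distrib,
    Finset.mul_sum]
  refine Finset.sum_eq_zero fun d _ => ?_
  linear_combination dag p X d b * h a d + X a d * h' d b -
    eps ((p a + p d) * (p d + p b)) * (X d b * h' a d + dag p X a d * h d b)

lemma gl_br_dag_apply_eq_zero {W X : Matrix I I ℂ} {c : ℂ} (hW : W ∈ diagMat I)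
    (h : (gl p).br W X = c • X) {a b : I} (hab : W a a ≠ W b b) :
    (gl p).br X (dag p X) a b = 0 := by
  refine (mul_eq_zero.1 (gl_br_dag_weight p (w := fun a => W a a) (c := c)
    (fun a b => ?_) a b)).resolve_left (sub_ne_zero.2 hab)
  rw [← gl_br_diag_apply p hW, h, Matrix.smul_apply, smul_eq_mul]

/-- Two vectors of the same parity have an even bracket. This eliminates the entries between an even
and an odd basis vector of weight zero, which diagonal matrices cannot separate. -/
lemma mpar_br_dag {i : ZMod 2} {X : Matrix I I ℂ} (hX : mpar p X = eps i • X) :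
    mpar p ((gl p).br X (dag p X)) = (gl p).br X (dag p X) := by
  have h := (gl p).parity_br X (dag p X)
  change mpar p _ = (gl p).br (mpar p X) (mpar p (dag p X)) at h
  rw [h, hX, mpar_dag p hX, map_smul, map_smul, LinearMap.smul_apply, smul_smul, eps_mul_self,
    one_smul]

end Matrices

/-! ### Opposite vectors in types `A` and `D` -/

section Types

variable {k l s t : ℕ}

lemma conj_qsgn (a : Idx k l s t) : (starRingEnd ℂ) (qsgn a) = qsgn a := by
  rcases a with (_ | _ | _) | (_ | _ | _) <;> simp [qsgn]

lemma eq_of_opp_eq {a : Idx k l s t} (h : opp a = a) :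
    (∃ i, a = .inl (.inr (.inr i))) ∨ ∃ j, a = .inr (.inr (.inr j)) := by
  rcases a with (_ | _ | i) | (_ | _ | j)
  any_goals simp [opp] at h
  · exact Or.inl ⟨i, rfl⟩
  · exact Or.inr ⟨j, rfl⟩

/-- A diagonal matrix separating a weight from the weight of another index. -/
lemma exists_diag_ne {a b : Idx k l s t} (hab : a ≠ b) (h : opp a ≠ a ∨ opp b ≠ b) :
    ∃ W ∈ diagMat (Idx k l s t), stAut ipar opp qsgn W = W ∧ W a a ≠ W b b := by
  have key : ∀ a : Idx k l s t, opp a ≠ a →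
      ∃ W ∈ diagMat (Idx k l s t), stAut ipar opp qsgn W = W ∧ ∀ b ≠ a, W a a ≠ W b b := by
    intro a ha
    -- The difference of the diagonal units at `a` and `opp a`: the automorphism negates and swaps
    -- opposite diagonal entries, so it is fixed, and the value `1` occurs only at `a`.
    refine ⟨Matrix.diagonal fun c => if c = a then 1 else if c = opp a then -1 else 0,
      fun c d hcd => Matrix.diagonal_apply_ne _ hcd, ?_, ?_⟩
    · ext c d
      by_cases hcd : c = d
      · subst hcd
        have e1 : opp c = a ↔ c = opp a :=
          ⟨fun h => by rw [← h, opp_opp], fun h => by rw [h, opp_opp]⟩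
        have e2 : opp c = opp a ↔ c = a :=
          ⟨fun h => by rw [← opp_opp c, h, opp_opp], fun h => by rw [h]⟩
        simp only [stAut_apply, qsgn_mul, add_self_zmod2, mul_zero, eps_zero,
          Matrix.diagonal_apply_eq, e1, e2]
        by_cases h1 : c = a
        · subst h1; simp [ha.symm]
        · by_cases h2 : c = opp a <;> simp [h1, h2, ha]
      · have h' : opp d ≠ opp c := fun e => hcd (by rw [← opp_opp c, ← e, opp_opp])
        simp [stAut_apply, hcd, h']
    · intro b hb
      simp only [Matrix.diagonal_apply_eq, if_true, if_neg hb]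
      split_ifs <;> norm_num
  rcases h with h | h
  · obtain ⟨W, h1, h2, h3⟩ := key a h
    exact ⟨W, h1, h2, h3 b hab.symm⟩
  · obtain ⟨W, h1, h2, h3⟩ := key b h
    exact ⟨W, h1, h2, (h3 a hab).symm⟩

lemma str_eq_zero_of_fixed {W : Matrix (Idx k l s t) (Idx k l s t) ℂ}
    (hW : stAut ipar opp qsgn W = W) : str ipar W = 0 := by
  have := str_stAut ipar opp_opp ipar_opp qsgn_mul W
  rw [hW] at this
  simpa [self_eq_neg] using this

/-- This lifts identities that hold modulo scalars to identities of matrices, once the diagonal is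
known to vanish. -/
lemma eq_zero_of_mem_scalars {X : sl k l s t} (hX : X ∈ scalars k l s t)
    (hd : ∀ a, X.1 a a = 0) : X = 0 := by
  obtain ⟨c, hc⟩ := mem_scalars hX
  refine Subtype.ext (Matrix.ext fun a b => ?_)
  have h := hd a
  rw [hc] at h ⊢
  have hc0 : c = 0 := by simpa using h
  simp [hc0]

lemma str_eq_zero_of_diag {X : Matrix (Idx k l s t) (Idx k l s t) ℂ} (hd : ∀ a, X a a = 0) :
    str ipar X = 0 := by
  simp [str_apply, hd]

/-- A vector of nonzero weight is represented by a matrix with zero diagonal. -/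
lemma exists_rep_diag_zero {x : AType k l s t} {φ : AType k l s t → ℂ}
    (hφ : ∀ w ∈ aCartan k l s t, aAut k l s t w = w → (aAlg k l s t).br w x = φ w • x)
    (hne : ∃ w ∈ aCartan k l s t, aAut k l s t w = w ∧ φ w ≠ 0) :
    ∃ X : sl k l s t, (scalars k l s t).mkQ X = x ∧ ∀ a, X.1 a a = 0 := by
  obtain ⟨w, hw, hσ, hw0⟩ := hne
  obtain ⟨X, rfl⟩ := Submodule.mkQ_surjective _ x
  have hbr := hφ w hw hσ
  obtain ⟨W, hW, rfl⟩ := hw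
  have hWd : W.1 ∈ diagMat _ := hW
  generalize φ ((scalars k l s t).mkQ W) = c at hw0 hbr
  have hmem : (slAlg k l s t).br W X - c • X ∈ scalars k l s t :=
    (Submodule.Quotient.eq _).1 hbr
  obtain ⟨r, hr⟩ := mem_scalars hmem
  -- A bracket with a diagonal matrix has zero diagonal, so `[W, X] - c X = r • 1` makes the
  -- diagonal of `X` constant. Subtracting this scalar matrix gives the required representative.
  have hd : ∀ a, X.1 a a = -r / c := by
    intro a
    have h : (gl ipar).br W.1 X.1 a a - c * X.1 a a = r * (1 : Matrix _ _ ℂ) a a :=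
      congrFun (congrFun hr a) a
    rw [gl_br_diag_apply _ hWd, Matrix.one_apply_eq] at h
    rw [eq_div_iff hw0]
    linear_combination -h
  have hs : str ipar (X.1 - (-r / c) • 1) = 0 := by
    refine str_eq_zero_of_diag fun a => ?_
    simp [hd]
  refine ⟨⟨_, hs⟩, ?_, fun a => by simp [hd]⟩
  refine (Submodule.Quotient.eq _).2 ?_
  refine Submodule.mem_span_singleton.2 ⟨-(-r / c), ?_⟩
  change _ = X.1 - (-r / c) • 1 - X.1
  module

/-- For the representative with zero diagonal, the parity, eigenvalue and weight relations hold
exactly and not merely modulo scalars, so `dag` can be applied to it. The bounds on `s` and `t`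
leave at most one weight-zero basis vector of each parity. -/
lemma aAlg_opposite (hs : Subsingleton (Fin s)) (ht : Subsingleton (Fin t)) {a : ℂ} (ha : a ≠ 0)
    {i : ZMod 2} {z : ℂ} {x : AType k l s t} {φ : AType k l s t → ℂ} (hx : x ≠ 0)
    (hpar : (aAlg k l s t).parity x = eps i • x) (hσ : aAut k l s t x = z • x)
    (hφ : ∀ w ∈ aCartan k l s t, aAut k l s t w = w → (aAlg k l s t).br w x = φ w • x)
    (hne : ∃ w ∈ aCartan k l s t, aAut k l s t w = w ∧ φ w ≠ 0) :
    ∃ y, (aAlg k l s t).parity y = eps i • y ∧ aAut k l s t y = (starRingEnd ℂ) z • y ∧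
      (∀ w ∈ aCartan k l s t, aAut k l s t w = w → (aAlg k l s t).br w y = -φ w • y) ∧
      aForm k l s t a x y ≠ 0 ∧ (aAlg k l s t).br x y ∈ aCartan k l s t := by
  obtain ⟨X, rfl, hd⟩ := exists_rep_diag_zero hφ hne
  have hXpar : mpar ipar X.1 = eps i • X.1 := by
    have hmem : (slAlg k l s t).parity X - eps i • X ∈ scalars k l s t :=
      (Submodule.Quotient.eq _).1 hpar
    refine sub_eq_zero.1 (congrArg Subtype.val (eq_zero_of_mem_scalars hmem fun b => ?_))
    change mpar ipar X.1 b b - eps i * X.1 b b = 0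
    simp [mpar_apply, hd]
  have hXσ : stAut ipar opp qsgn X.1 = z • X.1 := by
    have hmem : slAut k l s t X - z • X ∈ scalars k l s t := (Submodule.Quotient.eq _).1 hσ
    refine sub_eq_zero.1 (congrArg Subtype.val (eq_zero_of_mem_scalars hmem fun b => ?_))
    change stAut ipar opp qsgn X.1 b b - z * X.1 b b = 0
    simp [stAut_apply, hd]
  have hXφ : ∀ W : sl k l s t, W.1 ∈ diagMat _ →
      aAut k l s t ((scalars k l s t).mkQ W) = (scalars k l s t).mkQ W →
      (gl ipar).br W.1 X.1 = φ ((scalars k l s t).mkQ W) • X.1 := by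
    intro W hW hWσ
    have hbr := hφ _ ⟨W, hW, rfl⟩ hWσ
    generalize φ ((scalars k l s t).mkQ W) = c at hbr ⊢
    have hmem : (slAlg k l s t).br W X - c • X ∈ scalars k l s t :=
      (Submodule.Quotient.eq _).1 hbr
    refine sub_eq_zero.1 (congrArg Subtype.val (eq_zero_of_mem_scalars hmem fun b => ?_))
    change (gl ipar).br W.1 X.1 b b - c * X.1 b b = 0
    rw [gl_br_diag_apply _ hW, hd]
    ring
  have hX0 : X.1 ≠ 0 := fun h => hx (by rw [show X = 0 from Subtype.ext h, map_zero])
  have hYs : str ipar (dag ipar X.1) = 0 := str_eq_zero_of_diag fun b => by simp [dag_apply, hd]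
  refine ⟨(scalars k l s t).mkQ ⟨dag ipar X.1, hYs⟩, ?_, ?_, ?_, ?_, ?_⟩
  · exact congrArg (scalars k l s t).mkQ (Subtype.ext (mpar_dag ipar hXpar))
  · refine congrArg (scalars k l s t).mkQ (Subtype.ext ?_)
    change stAut ipar opp qsgn (dag ipar X.1) = (starRingEnd ℂ) z • dag ipar X.1
    rw [stAut_dag ipar ipar_opp conj_qsgn, hXσ, dag_smul]
  · rintro w ⟨W, hW, rfl⟩ hwσ
    exact congrArg (scalars k l s t).mkQ (Subtype.ext (gl_br_diag_dag ipar hW (hXφ W hW hwσ)))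
  · exact mul_ne_zero ha (str_mul_dag_ne_zero ipar hX0)
  · refine ⟨(slAlg k l s t).br X ⟨dag ipar X.1, hYs⟩, ?_, rfl⟩
    intro b c hbc
    change (gl ipar).br X.1 (dag ipar X.1) b c = 0
    by_cases h : opp b ≠ b ∨ opp c ≠ c
    · obtain ⟨W, hW, hWσ, hne⟩ := exists_diag_ne hbc h
      have hWs := str_eq_zero_of_fixed hWσ
      exact gl_br_dag_apply_eq_zero ipar hW (hXφ ⟨W, hWs⟩ hW
        (congrArg (scalars k l s t).mkQ (Subtype.ext hWσ))) hne
    -- Distinct self-opposite indices have different parities, so the entry is odd and vanishes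
    -- because the bracket is even.
    · have hp : ipar b + ipar c = 1 := by
        push Not at h
        rcases eq_of_opp_eq h.1 with ⟨i, rfl⟩ | ⟨i, rfl⟩ <;>
          rcases eq_of_opp_eq h.2 with ⟨j, rfl⟩ | ⟨j, rfl⟩
        · exact absurd (by rw [hs.elim i j]) hbc
        · rfl
        · rfl
        · exact absurd (by rw [ht.elim i j]) hbc
      have := congrFun (congrFun (mpar_br_dag ipar hXpar) b) c
      rw [mpar_apply, hp, eps_one] at this
      linear_combination (-1 / 2 : ℂ) * this

/-- Conjugation by the reflection negates the entries joining the two even vectors of weight zero,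
so its fixed points in the Cartan subalgebra are diagonal. -/
lemma dAlg_diag {W : osp k l 2 0} (hW : W ∈ dCartan k l) (hσ : dAut k l W = W) :
    W.1 ∈ diagMat _ := by
  intro b c hbc
  by_cases h : ∃ i j, b = .inl (.inr (.inr i)) ∧ c = .inl (.inr (.inr j))
  · obtain ⟨i, j, rfl, rfl⟩ := h
    have hij : i ≠ j := fun e => hbc (by rw [e])
    have e : reflMat k l W.1 = W.1 := congrArg Subtype.val hσ
    have := congrFun (congrFun e (.inl (.inr (.inr i)))) (.inl (.inr (.inr j)))
    rw [reflMat_apply] at this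
    fin_cases i <;> fin_cases j <;> simp [rsgn] at this hij ⊢ <;>
      linear_combination (-1 / 2 : ℂ) * this
  · exact hW b c hbc h

lemma reflMat_diag {W : Matrix (Idx k l 2 0) (Idx k l 2 0) ℂ} (hW : W ∈ diagMat _) :
    reflMat k l W = W := by
  ext b c
  rw [reflMat_apply]
  by_cases hbc : b = c
  · subst hbc; rw [rsgn_mul, one_mul]
  · rw [hW b c hbc, mul_zero]

lemma reflMat_dag (X : Matrix (Idx k l 2 0) (Idx k l 2 0) ℂ) :
    reflMat k l (dag ipar X) = dag ipar (reflMat k l X) := by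
  have h : ∀ b : Idx k l 2 0, (starRingEnd ℂ) (rsgn b) = rsgn b := by
    intro b
    unfold rsgn
    split
    · split_ifs <;> simp
    · simp
  ext b c
  simp only [reflMat_apply, dag_apply, map_mul, h]
  ring

/-- There is no quotient by scalars here, so `dag` applies directly and preserves `osp` by
`stAut_dag`. Entries of the bracket between the two weight-zero vectors are not separated by fixed
diagonal matrices, but `dCartan` allows them. -/
lemma dAlg_opposite {a : ℂ} (ha : a ≠ 0) {i : ZMod 2} {z : ℂ} {x : osp k l 2 0}
    {φ : osp k l 2 0 → ℂ} (hx : x ≠ 0)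
    (hpar : (dAlg k l).parity x = eps i • x) (hσ : dAut k l x = z • x)
    (hφ : ∀ w ∈ dCartan k l, dAut k l w = w → (dAlg k l).br w x = φ w • x) :
    ∃ y, (dAlg k l).parity y = eps i • y ∧ dAut k l y = (starRingEnd ℂ) z • y ∧
      (∀ w ∈ dCartan k l, dAut k l w = w → (dAlg k l).br w y = -φ w • y) ∧
      a * str ipar (x.1 * y.1) ≠ 0 ∧ (dAlg k l).br x y ∈ dCartan k l := by
  have hXpar : mpar ipar x.1 = eps i • x.1 := congrArg Subtype.val hpar
  have hXσ : reflMat k l x.1 = z • x.1 := congrArg Subtype.val hσ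
  have hX0 : x.1 ≠ 0 := fun h => hx (Subtype.ext h)
  have hY : dag ipar x.1 ∈ osp k l 2 0 := by
    change stAut ipar opp qsgn (dag ipar x.1) = dag ipar x.1
    rw [stAut_dag ipar ipar_opp conj_qsgn, osp_fix x.2]
  refine ⟨⟨dag ipar x.1, hY⟩, Subtype.ext (mpar_dag ipar hXpar), ?_, ?_,
    mul_ne_zero ha (str_mul_dag_ne_zero ipar hX0), ?_⟩
  · refine Subtype.ext ?_
    change reflMat k l (dag ipar x.1) = (starRingEnd ℂ) z • dag ipar x.1
    rw [reflMat_dag, hXσ, dag_smul]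
  · exact fun w hw hwσ => Subtype.ext (gl_br_diag_dag ipar (dAlg_diag hw hwσ)
      (congrArg Subtype.val (hφ w hw hwσ)))
  · intro b c hbc h
    change (gl ipar).br x.1 (dag ipar x.1) b c = 0
    have hfix : opp b ≠ b ∨ opp c ≠ c := by
      by_contra! hf
      refine h ?_
      rcases eq_of_opp_eq hf.1 with ⟨i, rfl⟩ | ⟨i, rfl⟩
      · rcases eq_of_opp_eq hf.2 with ⟨j, rfl⟩ | ⟨j, rfl⟩
        · exact ⟨i, j, rfl, rfl⟩
        · exact j.elim0
      · exact i.elim0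
    obtain ⟨W, hW, hWσ, hne⟩ := exists_diag_ne hbc hfix
    exact gl_br_dag_apply_eq_zero ipar hW (congrArg Subtype.val (hφ ⟨W, hWσ⟩
      (fun b c hbc _ => hW b c hbc) (Subtype.ext (reflMat_diag hW)))) hne

end Types

/-! ### All types together -/

lemma conj_zpow_of_isPrimitiveRoot {ζ : ℂ} {n : ℕ} (hn : n ≠ 0) (h : IsPrimitiveRoot ζ n)
    (p : ℤ) : (starRingEnd ℂ) (ζ ^ p) = ζ ^ (-p) := by
  rw [map_zpow₀, zpow_neg, ← inv_zpow, Complex.inv_def, Complex.normSq_eq_norm_sq,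
    h.norm'_eq_one hn]
  simp

lemma TwistedType.order_ne_zero (T : TwistedType) : T.order ≠ 0 := by
  cases T <;> simp [TwistedType.order]

/-- Because `ζ` has modulus one, the conjugate eigenvalue produced by `dag` is `ζ ^ (-p)`. -/
lemma TwistedType.hasOpposites (T : TwistedType) {a : ℂ} (ha : a ≠ 0) {ζ : ℂ} (hζ : ζ ≠ 0)
    (h : IsPrimitiveRoot ζ T.order) : (T.data a ha ζ hζ).HasOpposites := by
  have hz := conj_zpow_of_isPrimitiveRoot T.order_ne_zero h
  cases T <;> intro i p x φ hx hpar hσ hφ hne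
  case AEvenOdd k l hl =>
    have := aAlg_opposite (s := 1) (t := 0) inferInstance inferInstance ha (z := ζ ^ p) hx hpar hσ hφ hne
    rwa [hz p] at this
  case AOddOdd k l hk hl hkl =>
    have := aAlg_opposite (s := 0) (t := 0) inferInstance inferInstance ha (z := ζ ^ p) hx hpar hσ hφ hne
    rwa [hz p] at this
  case AEvenEven k l hl =>
    have := aAlg_opposite (s := 1) (t := 1) inferInstance inferInstance ha (z := ζ ^ p) hx hpar hσ hφ hne
    rwa [hz p] at this
  case D k l hl =>
    have := dAlg_opposite ha (z := ζ ^ p) hx hpar hσ hφ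
    rwa [hz p] at this

/-! ### Unboundedness of weight multiplicities -/

section Casimir

variable {M : Type*} [AddCommGroup M] [Module ℂ M]

/-- The Casimir operator of the rank one Lie algebra with `[e, f] = h`, `[h, e] = c e`,
`[h, f] = -c f`. -/
noncomputable def casimir (c : ℂ) (E F H : Module.End ℂ M) : Module.End ℂ M :=
  (2 * c) • (F * E) + H * H + c • H

lemma casimir_apply (c : ℂ) (E F H : Module.End ℂ M) (v : M) :
    casimir c E F H v = (2 * c) • F (E v) + H (H v) + c • H v := rfl

/-- Commutation with `F` is enough, since eigenvectors will be carried along `F` and along operators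
commuting with `E` and `F`. -/
lemma casimir_commute {c : ℂ} {E F H : Module.End ℂ M} (hEF : ∀ v, E (F v) = F (E v) + H v)
    (hHF : ∀ v, H (F v) = F (H v) - c • F v) : Commute (casimir c E F H) F := by
  refine LinearMap.ext fun v => ?_
  change casimir c E F H (F v) = F (casimir c E F H v)
  simp only [casimir_apply, hEF, hHF, map_add, map_sub, map_smul]
  module

/-- An operator commuting with `E` and `F` commutes with `H = E F - F E`, hence with every term. -/
lemma casimir_commute_of_commute {c : ℂ} {E F H X : Module.End ℂ M}
    (hEF : ∀ v, E (F v) = F (E v) + H v) (hE : Commute X E) (hF : Commute X F) :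
    Commute (casimir c E F H) X := by
  have hH : H = E * F - F * E := LinearMap.ext fun v => by
    change H v = E (F v) - F (E v)
    rw [hEF]; abel
  have hXH : Commute X H := hH ▸ (hE.mul_right hF).sub_right (hF.mul_right hE)
  exact ((((hF.mul_right hE).smul_right _).add_right (hXH.mul_right hXH)).add_right
    (hXH.smul_right _)).symm

end Casimir

/-! ### Root vectors acting on a weight module -/

namespace SuperModule

variable {D : TwistData} {M : Type*} [AddCommGroup M] [Module ℂ M] (ρ : SuperModule D.lie M)

lemma act_mem_weightSpace {γ ν : D.HDual} {x : D.L} {i : ZMod 2} (hx : x ∈ D.rootSpace γ)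
    (hxi : x ∈ D.lie.part i) {v : M} (hv : v ∈ ρ.weightSpace ν) :
    ρ.act x v ∈ ρ.weightSpace (ν + γ) := by
  intro T
  have h := ρ.act_br 0 i T (D.parity_hh T) x hxi v
  rw [D.mem_rootSpace.1 hx T, map_smul, LinearMap.smul_apply, zero_mul, eps_zero, one_smul,
    hv T, map_smul, eq_sub_iff_add_eq] at h
  rw [← h, LinearMap.add_apply]
  module

lemma pow_mem_weightSpace {γ : D.HDual} {T : Module.End ℂ M}
    (hT : ∀ ν v, v ∈ ρ.weightSpace ν → T v ∈ ρ.weightSpace (ν + γ)) (m : ℕ) {ν : D.HDual} {v : M}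
    (hv : v ∈ ρ.weightSpace ν) : (T ^ m) v ∈ ρ.weightSpace (ν + m • γ) := by
  induction m with
  | zero => simpa using hv
  | succ m ih =>
    rw [pow_succ', succ_nsmul, ← add_assoc]
    exact hT _ _ ih

/-- The bracket vanishes since its weight is not a root. Evenness of `y` makes the sign trivial, so
the operators truly commute, even for odd `x`. -/
lemma commute_act {γ δ : D.HDual} {x y : D.L} {i : ZMod 2} (hx : x ∈ D.rootSpace γ)
    (hxi : x ∈ D.lie.part i) (hy : y ∈ D.rootSpace δ) (hyi : y ∈ D.lie.part 0)
    (h : δ + γ ∉ D.R) : Commute (ρ.act x) (ρ.act y) := by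
  refine LinearMap.ext fun v => ?_
  have hb := ρ.act_br 0 i y hyi x hxi v
  rw [D.br_eq_zero hy hyi hx h, map_zero, LinearMap.zero_apply, zero_mul, eps_zero, one_smul] at hb
  exact (sub_eq_zero.1 hb.symm).symm

/-- An injective operator shifting weights by `∑ β i` and commuting with the root vectors for
`α` and `-α`. -/
lemma exists_injective_shift {α : D.HDual} {e f : D.L} (he : e ∈ D.rootSpace α)
    (hei : e ∈ D.lie.part 0) (hf : f ∈ D.rootSpace (-α)) (hfi : f ∈ D.lie.part 0)
    {ι : Type*} (β : ι → D.HDual) (hβ : ∀ i, β i ∈ ρ.Rin) (hadd : ∀ i, α + β i ∉ D.R)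
    (hsub : ∀ i, -α + β i ∉ D.R) (S : Finset ι) :
    ∃ X : Module.End ℂ M, Function.Injective X ∧ Commute X (ρ.act e) ∧ Commute X (ρ.act f) ∧
      ∀ ν v, v ∈ ρ.weightSpace ν → X v ∈ ρ.weightSpace (ν + ∑ i ∈ S, β i) := by
  classical
  induction S using Finset.induction_on with
  | empty =>
    exact ⟨1, Function.injective_id, Commute.one_left _, Commute.one_left _,
      fun ν v hv => by simpa using hv⟩
  | insert a S ha ih =>
    obtain ⟨X, h1, h2, h3, h4⟩ := ih
    obtain ⟨⟨hR, -⟩, hinj⟩ := hβ a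
    obtain ⟨i, x, hx, hxi, hx0⟩ := TwistData.exists_homogeneous_of_mem_R hR
    refine ⟨X * ρ.act x, h1.comp (hinj x hx hx0),
      h2.mul_left (ρ.commute_act hx hxi he hei (hadd a)),
      h3.mul_left (ρ.commute_act hx hxi hf hfi (hsub a)), fun ν v hv => ?_⟩
    rw [Finset.sum_insert ha, ← add_assoc]
    exact h4 _ _ (ρ.act_mem_weightSpace hx hxi hv)

/-- Take the last power of `T` not annihilating `v`. -/
lemma exists_top {T : Module.End ℂ M} (hT : ∀ v, ∃ n : ℕ, (T ^ n) v = 0) {v : M} (hv : v ≠ 0) :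
    ∃ m : ℕ, (T ^ m) v ≠ 0 ∧ T ((T ^ m) v) = 0 := by
  classical
  have h := Nat.find_spec (hT v)
  obtain ⟨m, hm⟩ : ∃ m, Nat.find (hT v) = m + 1 :=
    Nat.exists_eq_succ_of_ne_zero fun h0 => hv (by rw [h0] at h; simpa using h)
  refine ⟨m, Nat.find_min (hT v) (by omega), ?_⟩
  rw [hm, pow_succ'] at h
  exact h

lemma sl2_relations {α : D.HDual} {e f : D.L} (hei : e ∈ D.lie.part 0) (hf : f ∈ D.rootSpace (-α)) (hfi : f ∈ D.lie.part 0)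
    (hef : D.lie.br e f ∈ D.hh) :
    (∀ v, ρ.act e (ρ.act f v) = ρ.act f (ρ.act e v) + ρ.act (D.lie.br e f) v) ∧
    (∀ v, ρ.act (D.lie.br e f) (ρ.act f v) = ρ.act f (ρ.act (D.lie.br e f) v) -
      α ⟨D.lie.br e f, hef⟩ • ρ.act f v) := by
  refine ⟨fun v => ?_, fun v => ?_⟩
  · rw [ρ.act_br 0 0 e hei f hfi, zero_mul, eps_zero, one_smul]
    abel
  · have h := ρ.act_br 0 0 _ (D.parity_hh ⟨D.lie.br e f, hef⟩) f hfi v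
    rw [D.mem_rootSpace.1 hf, map_smul, LinearMap.smul_apply, zero_mul, eps_zero, one_smul,
      LinearMap.neg_apply] at h
    rw [sub_eq_add_neg, ← neg_smul, h]
    abel

/-- The weight multiplicities of a weight module are unbounded if it has weights of the form
`μ + s α + (s + 1) ∑ β i` for arbitrarily large `s`, where root vectors for `α` are locally
nilpotent, and those for `-α` and for the `β i`, orthogonal to `α`, are injective. -/
theorem not_bounded (hD : D.HasOpposites) (hfin : ∀ ν, FiniteDimensional ℂ (ρ.weightSpace ν))
    {α : D.HDual} (hα₀ : α ∈ D.R₀) (hα : α ∈ ρ.Rln) (hα_neg : -α ∈ ρ.Rin)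
    {t : ℕ} (β : Fin t → D.HDual) (hβ : ∀ i, β i ∈ ρ.Rin)
    (horth : ∀ i, D.dualForm α (β i) = 0)
    (hadd : ∀ i, α + β i ∉ D.R) (hsub : ∀ i, α - β i ∉ D.R) (μ : D.HDual)
    (s : ℕ → ℕ) (hs : StrictMono s)
    (hsupp : ∀ n, μ + s n • α + (s n + 1) • ∑ i, β i ∈ ρ.supp) :
    ¬ ∃ N : ℕ, ∀ ν : D.HDual, Module.finrank ℂ (ρ.weightSpace ν) ≤ N := by
  rintro ⟨N, hN⟩
  obtain ⟨⟨hαR, hαα⟩, hnil⟩ := hα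
  -- Negation is known to preserve only roots not orthogonal to some root; here `(-α + β_i, α) =
  -- -(α, α) ≠ 0`.
  have hsub' : ∀ i, -α + β i ∉ D.R := by
    intro i hi
    refine hsub i ?_
    have := hD.neg_mem_R hαR ?_ hi
    · rwa [neg_add, neg_neg, ← sub_eq_add_neg] at this
    · rw [TwistData.dualForm_eq, LinearMap.add_apply, LinearMap.neg_apply,
        ← TwistData.dualForm_eq, ← TwistData.dualForm_eq, D.dualForm_comm (β i), horth, add_zero]
      exact neg_ne_zero.2 hαα
  obtain ⟨e, ⟨he, hei⟩, he0⟩ := Submodule.exists_mem_ne_zero_of_ne_bot hα₀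
  obtain ⟨f, hf, hfi, hκ, hef⟩ := hD.exists_rootSpace_neg hαR hαα he he0 hei
  have hf0 : f ≠ 0 := by rintro rfl; exact hκ (map_zero _)
  obtain ⟨hEF, hHF⟩ := ρ.sl2_relations hei hf hfi hef
  -- As `[e, f] = (e, f) t_α`, orthogonality makes the `β_i` vanish on it, while `α` takes the value
  -- `(e, f) (α, α) ≠ 0`.
  have hβh : (∑ i, β i) ⟨D.lie.br e f, hef⟩ = 0 := by
    rw [LinearMap.sum_apply]
    refine Finset.sum_eq_zero fun i _ => ?_
    rw [TwistData.apply_br hfi hf, horth, mul_zero]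
  have hc : α ⟨D.lie.br e f, hef⟩ ≠ 0 := by
    rw [TwistData.apply_br hfi hf]
    exact mul_ne_zero hκ hαα
  obtain ⟨X, hXinj, hXE, hXF, hX⟩ :=
    ρ.exists_injective_shift he hei hf hfi β hβ hadd hsub' Finset.univ
  have hH : ∀ ν v, v ∈ ρ.weightSpace ν →
      ρ.act (D.lie.br e f) v = ν ⟨D.lie.br e f, hef⟩ • v := fun ν v hv => hv ⟨_, hef⟩
  have hE : ∀ ν v, v ∈ ρ.weightSpace ν → ρ.act e v ∈ ρ.weightSpace (ν + α) :=
    fun ν v hv => ρ.act_mem_weightSpace he hei hv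
  have hF : ∀ ν v, v ∈ ρ.weightSpace ν → ρ.act f v ∈ ρ.weightSpace (ν + -α) :=
    fun ν v hv => ρ.act_mem_weightSpace hf hfi hv
  have hFinj : Function.Injective (ρ.act f) := hα_neg.2 f hf hf0
  have hEnil := hnil e he he0
  have hΩF := casimir_commute hEF hHF
  have hΩX := casimir_commute_of_commute (c := α ⟨D.lie.br e f, hef⟩) hEF hXE hXF
  generalize ρ.act (D.lie.br e f) = H at hEF hH hΩF hΩX
  generalize (⟨D.lie.br e f, hef⟩ : D.hh) = T at hβh hc hH hΩF hΩX
  generalize ρ.act e = E at *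
  generalize ρ.act f = F at *
  -- highest weight vectors
  have hw : ∀ n, ∃ m : ℕ, ∃ w : M, w ≠ 0 ∧ E w = 0 ∧
      w ∈ ρ.weightSpace (μ + (s n + m) • α + (s n + 1) • ∑ i, β i) := by
    intro n
    obtain ⟨v, hv, hv0⟩ := Submodule.exists_mem_ne_zero_of_ne_bot (hsupp n)
    obtain ⟨m, hm0, hm⟩ := exists_top hEnil hv0
    refine ⟨m, _, hm0, hm, ?_⟩
    have := ρ.pow_mem_weightSpace hE m hv
    rwa [add_right_comm, add_assoc μ, ← add_nsmul] at this
  choose m w hw0 hEw hw using hw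
  -- The number `m n` of raising steps is uncontrolled, so `s n + m n` need not be monotone. It
  -- dominates `s n ≥ n`, so a subsequence is strictly increasing.
  have hk : Filter.Tendsto (fun n => s n + m n) Filter.atTop Filter.atTop :=
    Filter.tendsto_atTop_mono (fun n => (hs.id_le n).trans (Nat.le_add_right _ _)) Filter.tendsto_id
  obtain ⟨φ, hφ, hkφ⟩ := Filter.strictMono_subseq_of_tendsto_atTop hk
  -- Keeping all `k j` at least `B` makes two distinct values of `k` give distinct Casimir
  -- eigenvalues.
  obtain ⟨B, hB⟩ := exists_nat_ge ‖2 * μ T / α T‖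
  let n : Fin (N + 1) → ℕ := fun j => φ (j + B)
  let k : Fin (N + 1) → ℕ := fun j => s (n j) + m (n j)
  have hkinj : Function.Injective k := fun i j hij =>
    Fin.ext (Nat.add_right_cancel (hkφ.injective hij))
  have hkB : ∀ j, B ≤ k j := fun j =>
    ((Nat.le_add_left B j).trans (hφ.id_le _)).trans ((hs.id_le _).trans (Nat.le_add_right _ _))
  -- A common bound for the coefficients of `∑ β i`, so that powers of `X` can raise each of them to
  -- the same `Q`.
  obtain ⟨Q, hQ⟩ : ∃ Q, ∀ j, s (n j) + 1 ≤ Q :=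
    ⟨∑ j, (s (n j) + 1), fun j => Finset.single_le_sum (f := fun j => s (n j) + 1)
      (fun _ _ => Nat.zero_le _) (Finset.mem_univ j)⟩
  -- `F ^ k j` cancels the `α`-part of the weight, and the power of `X` completes the coefficient of
  -- `∑ β i` to `Q`.
  let u : Fin (N + 1) → M := fun j => (X ^ (Q - (s (n j) + 1))) ((F ^ k j) (w (n j)))
  have hu0 : ∀ j, u j ≠ 0 := by
    intro j
    have hp : ∀ {Y : Module.End ℂ M}, Function.Injective Y → ∀ r : ℕ,
        Function.Injective (Y ^ r) := fun hY r => by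
      rw [Module.End.coe_pow]; exact hY.iterate r
    exact fun h => hw0 (n j) (hp hFinj _ (hp hXinj _ (h.trans (by simp))))
  have hu : ∀ j, u j ∈ ρ.weightSpace (μ + Q • ∑ i, β i) := by
    intro j
    have := ρ.pow_mem_weightSpace hX (Q - (s (n j) + 1)) (ρ.pow_mem_weightSpace hF (k j) (hw (n j)))
    have e : μ + (s (n j) + m (n j)) • α + (s (n j) + 1) • ∑ i, β i + k j • -α +
        (Q - (s (n j) + 1)) • ∑ i, β i = μ + Q • ∑ i, β i := by
      obtain ⟨r, hr⟩ := Nat.exists_eq_add_of_le (hQ j)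
      rw [hr, Nat.add_sub_cancel_left, smul_neg, add_nsmul _ (s (n j) + 1) r,
        show s (n j) + m (n j) = k j from rfl]
      abel
    rwa [e] at this
  -- The `H`-eigenvalue of `w (n j)`, to which `∑ β i` contributes nothing. As `E` kills this
  -- vector, its Casimir eigenvalue is `η ^ 2 + α(T) η`.
  let η : Fin (N + 1) → ℂ := fun j => μ T + k j * α T
  have hΩ : ∀ j, casimir (α T) E F H (u j) = (η j * η j + α T * η j) • u j := by
    intro j
    have h1 : casimir (α T) E F H (w (n j)) = (η j * η j + α T * η j) • w (n j) := by
      have e : H (w (n j)) = η j • w (n j) := by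
        rw [hH _ _ (hw (n j))]
        congr 1
        simp only [LinearMap.add_apply, LinearMap.smul_apply, hβh, smul_zero, add_zero, η, k,
          nsmul_eq_mul]
      rw [casimir_apply, hEw, map_zero, smul_zero, zero_add, e, map_smul, e]
      module
    have h2 := LinearMap.congr_fun (((hΩX.pow_right (Q - (s (n j) + 1))).mul_right
      (hΩF.pow_right (k j))).eq) (w (n j))
    change casimir (α T) E F H (u j) =
      (X ^ (Q - (s (n j) + 1))) ((F ^ k j) (casimir (α T) E F H (w (n j)))) at h2
    rw [h2, h1, map_smul, map_smul]
  have hηinj : Function.Injective fun j => η j * η j + α T * η j := by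
    intro i j hij
    -- The difference of the two eigenvalues, factored.
    have h : α T * (k i - k j) * (2 * μ T + α T * (k i + k j + 1)) = 0 := by
      simp only [η] at hij
      linear_combination hij
    rcases mul_eq_zero.1 h with h | h
    · exact hkinj (by exact_mod_cast sub_eq_zero.1 ((mul_eq_zero.1 h).resolve_left hc))
    -- Vanishing of the second factor gives `‖2 μ(T) / α(T)‖ = k i + k j + 1`, which exceeds `B`
    -- since `B ≤ k i`.
    · exfalso
      have e : 2 * μ T / α T = -((k i + k j + 1 : ℕ) : ℂ) := by
        rw [div_eq_iff hc]
        push_cast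
        linear_combination h
      rw [e, norm_neg, Complex.norm_natCast] at hB
      have := hkB i
      have : k i + k j + 1 ≤ B := by exact_mod_cast hB
      omega
  -- Nonzero eigenvectors with distinct eigenvalues: `N + 1` independent vectors in one weight
  -- space.
  have hli : LinearIndependent ℂ u :=
    Module.End.eigenvectors_linearIndependent' (casimir (α T) E F H) _ hηinj u
      fun j => Module.End.hasEigenvector_iff.2 ⟨Module.End.mem_eigenspace_iff.2 (hΩ j), hu0 j⟩
  have hli' : LinearIndependent ℂ
      (fun j => (⟨u j, hu j⟩ : ρ.weightSpace (μ + Q • ∑ i, β i))) :=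
    LinearIndependent.of_comp (Submodule.subtype _) hli
  have := hli'.fintype_card_le_finrank
  rw [Fintype.card_fin] at this
  exact absurd (this.trans (hN _)) (by omega)

end SuperModule

end TwistedAffine

theorem theorem3p3 (T : TwistedType) (a : ℂ) (ha : a ≠ 0) (ζ : ℂ) (hζ : ζ ≠ 0)
    (hζ_prim : IsPrimitiveRoot ζ T.order)
    {M : Type*} [AddCommGroup M] [Module ℂ M] (ρ : SuperModule (T.data a ha ζ hζ).lie M)
    (hfin : ρ.IsFiniteWeight) (hshadow : ρ.HasShadow)
    (α : (T.data a ha ζ hζ).HDual) (hα₀ : α ∈ (T.data a ha ζ hζ).R₀) (hα : α ∈ ρ.Rln)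
    (hα_neg : -α ∈ ρ.Rin)
    {t : ℕ} (β : Fin t → (T.data a ha ζ hζ).HDual) (hβ : ∀ i, β i ∈ ρ.Rin)
    (horth : ∀ i, (T.data a ha ζ hζ).dualForm α (β i) = 0)
    (hadd : ∀ i, α + β i ∉ (T.data a ha ζ hζ).R) (hsub : ∀ i, α - β i ∉ (T.data a ha ζ hζ).R)
    (μ : (T.data a ha ζ hζ).HDual) (hμ : μ ∈ ρ.supp)
    (s : ℕ → ℕ) (hs_pos : ∀ n, 0 < s n) (hs : StrictMono s)
    (hsupp : ∀ n, μ + s n • α + (s n + 1) • ∑ i, β i ∈ ρ.supp) :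
    ¬ ∃ N : ℕ, ∀ ν : (T.data a ha ζ hζ).HDual, Module.finrank ℂ (ρ.weightSpace ν) ≤ N := by
  exact ρ.not_bounded (T.hasOpposites ha hζ hζ_prim) hfin.2 hα₀ hα hα_neg β hβ horth hadd hsub μ s hs
    hsupp
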